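/- **Setting.** Let $L/K$ be a finite Galois extension of fields of characteristic $p>0$ with Galois group $\Gamma$, and let $G$ be a finite group. A block idempotent of an algebra is a primitive idempotent of its centre. For a field $k$ of characteristic $p$ and a subgroup $P\le G$, regard $kC_G(P)$ as a subalgebra of $kG$, and let $\mathrm{Br}_P\colon kG\to kC_G(P)$ be the $k$-linear projection that forgets the coefficients outside $C_G(P)$. A $kG$-Brauer pair is a pair $(P,e)$ with $P$ a $p$-subgroup of $G$ and $e$ a block idempotent of $kC_G(P)$. For a block idempotent $b$ of $kG$, it is a $(kG,b)$-Brauer pair if $\mathrm{Br}_P(b)e=e$; the set of these is $\mathcal{BP}(kGb)$. Write $(Q,f)\le(P,e)$ if $Q\le P$ and every primitive idempotent $i$ of the fixed point algebra $(kG)^P$ with $e\,\mathrm{Br}_P(i)=\mathrm{Br}_P(i)\ne0$ also satisfies $f\,\mathrm{Br}_Q(i)=\mathrm{Br}_Q(i)\neq 0$. The group $G$ acts on $kG$-Brauer pairs by conjugation; $N_G(P,e)$ denotes the stabilizer of $(P,e)$ in $G$. The group $\Gamma$ acts on $LG$ through the coefficients and on $LG$-Brauer pairs by ${}^{\gamma}(P,e)=(P,{}^{\gamma}e)$;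 the two actions commute and give an action of $G\times\Gamma$ on $LG$-Brauer pairs. A subscript on $\Gamma$ denotes a stabilizer. For a block idempotent $e$ of $LC_G(P)$ put $\tilde e:=\sum_{\gamma\in[\Gamma/\Gamma_e]}{}^{\gamma}e$, the sum of the distinct $\Gamma$-conjugates of $e$; it is a block idempotent of $KC_G(P)$. For $a\in LG$ let $K(a)\subseteq L$ be the field obtained by adjoining the coefficients of $a$ to $K$. For a subgroup $X\le G\times\Gamma$ with projections $p_1(X)\le G$ and $p_2(X)\le\Gamma$, put $k_1(X):=\{g\in G\mid (g,1)\in X\}$ and $k_2(X):=\{\gamma\in\Gamma\mid(1,\gamma)\in X\}$. Let $b$ be a block idempotent of $LG$ and let $(P,e)$ be a maximal element of $\mathcal{BP}(LGb)$ with respect to $\le$. For $Q\le P$ let $e_Q$ be the unique block idempotent of $LC_G(Q)$ with $(Q,e_Q)\le(P,e)$. **Proposition 5.1.** (a) Whenever $R\le Q\le P$ and $(R,e_R)\le(Q,e_Q)$, one has $$\Gamma_e=\Gamma_{(P,e)}\le\Gamma_{(Q,e_Q)}\le\Gamma_{(R,e_R)}\le\Gamma_{(\{1\},b)}=\Gamma_b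 .$$ In particular, $K(b)\subseteq K(e)$. (b) Let $X$ be the stabilizer of $(P,e)$ in $G\times\Gamma$. Then $$k_1(X)=N_G(P,e),\quad p_1(X)=N_G(P,\tilde e),\quad k_2(X)=\Gamma_e,\quad p_2(X)=\Gamma_b .$$ (c) One has $N_G(P,e)\trianglelefteq N_G(P,\tilde e)$ and $\Gamma_e\trianglelefteq\Gamma_b$, and $N_G(P,\tilde e)/N_G(P,e)\cong\Gamma_b/\Gamma_e$. Moreover, $K(e)/K(b)$ is a Galois extension whose Galois group is cyclic and isomorphic to $N_G(P,\tilde e)/N_G(P,e)$. -/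

import Mathlib

open scoped Pointwise

noncomputable section

namespace BlockTheory

/-! ### Idempotents and blocks -/

/-- `e` is a primitive idempotent of the subalgebra `S`: a nonzero idempotent of `S` that is not the
sum of two nonzero orthogonal idempotents of `S`. -/
structure IsPrimitiveIdempotent {k A : Type*} [CommRing k] [Ring A] [Algebra k A]
    (S : Subalgebra k A) (e : A) : Prop where
  mem : e ∈ S
  idem : e * e = e
  ne_zero : e ≠ 0
  eq_zero_or : ∀ f ∈ S, ∀ g ∈ S, f * f = f → g * g = g → f * g = 0 → g * f = 0 →
    e = f + g → f = 0 ∨ g = 0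

/-- The centre `Z(S)` of a subalgebra `S` of `A`, as a subalgebra of `A`. -/
def centerOf {k A : Type*} [CommRing k] [Ring A] [Algebra k A] (S : Subalgebra k A) :
    Subalgebra k A :=
  S ⊓ Subalgebra.centralizer k (S : Set A)

/-- `e` is a block idempotent of the algebra `S`: a primitive idempotent of `Z(S)`. -/
def IsBlockIdempotent {k A : Type*} [CommRing k] [Ring A] [Algebra k A]
    (S : Subalgebra k A) (e : A) : Prop :=
  IsPrimitiveIdempotent (centerOf S) e

/-! ### Group algebras -/

/-- The `k`-linear extension `c_x : kG → kG` of conjugation `g ↦ x g x⁻¹`. -/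
def conj (k : Type*) {G : Type*} [Field k] [Group G] (x : G) :
    MonoidAlgebra k G ≃ₐ[k] MonoidAlgebra k G :=
  MonoidAlgebra.domCongr k k (MulAut.conj x)

theorem coeff_conj {k G : Type*} [Field k] [Group G] (x : G) (a : MonoidAlgebra k G) (g : G) :
    (conj k x a).coeff g = a.coeff (x⁻¹ * g * x) := by
  simp [conj]

theorem conj_mul {k G : Type*} [Field k] [Group G] (x y : G) (a : MonoidAlgebra k G) :
    conj k (x * y) a = conj k x (conj k y a) := by
  ext g; simp only [coeff_conj]; congr 1; group

theorem conj_one {k G : Type*} [Field k] [Group G] (a : MonoidAlgebra k G) :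
    conj k 1 a = a := by
  ext g; simp [coeff_conj]

/-- The group algebra `k C_G(Q)`, as the subalgebra of `kG` of all elements supported on the
centralizer `C_G(Q)`. -/
def centralizerAlgebra (k : Type*) {G : Type*} [Field k] [Group G] (Q : Subgroup G) :
    Subalgebra k (MonoidAlgebra k G) where
  carrier := {a | ∀ g, a.coeff g ≠ 0 → g ∈ Subgroup.centralizer (Q : Set G)}
  mul_mem' := by
    classical
    intro a b ha hb g hg
    have h := MonoidAlgebra.support_coeff_mul_subset a b (Finsupp.mem_support_iff.2 hg)
    obtain ⟨x, hx, y, hy, rfl⟩ := Finset.mem_mul.1 h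
    exact mul_mem (ha x (Finsupp.mem_support_iff.1 hx)) (hb y (Finsupp.mem_support_iff.1 hy))
  add_mem' := by
    intro a b ha hb g hg
    by_cases h : a.coeff g = 0
    · exact hb g (by simpa [h] using hg)
    · exact ha g h
  algebraMap_mem' := by
    classical
    intro r g hg
    have : g = 1 := by
      by_contra h
      apply hg
      simp [Ne.symm h]
    exact this ▸ one_mem _

/-- The algebra `(kG)^Q` of fixed points of `Q` on `kG` under conjugation. -/
def fixedAlgebra (k : Type*) {G : Type*} [Field k] [Group G] (Q : Subgroup G) :
    Subalgebra k (MonoidAlgebra k G) where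
  carrier := {a | ∀ x ∈ Q, conj k x a = a}
  mul_mem' := by
    intro a b ha hb x hx
    rw [map_mul, ha x hx, hb x hx]
  add_mem' := by
    intro a b ha hb x hx
    rw [map_add, ha x hx, hb x hx]
  algebraMap_mem' := fun r x _ => AlgEquiv.commutes (conj k x) r

open Classical in
/-- The Brauer map `Br_Q`: the `k`-linear projection of `kG` onto `k C_G(Q)` that forgets the
coefficients outside `C_G(Q)`. -/
def brauerMap {k G : Type*} [Field k] [Group G] (Q : Subgroup G) (a : MonoidAlgebra k G) :
    MonoidAlgebra k G :=
  MonoidAlgebra.ofCoeff (a.coeff.filter (· ∈ Subgroup.centralizer (Q : Set G)))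

theorem mem_centerOf_centralizerAlgebra {k G : Type*} [Field k] [Group G] {Q : Subgroup G}
    {a : MonoidAlgebra k G} :
    a ∈ centerOf (centralizerAlgebra k Q) ↔
      (∀ g, a.coeff g ≠ 0 → g ∈ Subgroup.centralizer (Q : Set G)) ∧
      ∀ x ∈ Subgroup.centralizer (Q : Set G), ∀ g, a.coeff (x⁻¹ * g * x) = a.coeff g := by
  classical
  refine and_congr Iff.rfl ⟨fun h x hx g => ?_, fun h => ?_⟩
  · have h1 : MonoidAlgebra.single x (1 : k) ∈ centralizerAlgebra k Q := by
      intro g hg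
      have : x = g := by
        by_contra h'
        exact hg (by simp [h'])
      exact this ▸ hx
    have h2 := (Subalgebra.mem_centralizer_iff k).1 h _ h1
    have h3 := congrArg (fun c => c.coeff (g * x)) h2
    rw [MonoidAlgebra.coeff_single_mul_apply, MonoidAlgebra.coeff_mul_single_apply] at h3
    simpa [mul_assoc] using h3
  · refine (Subalgebra.mem_centralizer_iff k).2 fun c hc => ?_
    have key : ∀ x ∈ Subgroup.centralizer (Q : Set G), ∀ r : k,
        MonoidAlgebra.single x r * a = a * MonoidAlgebra.single x r := by
      intro x hx r
      ext g
      rw [MonoidAlgebra.coeff_single_mul_apply, MonoidAlgebra.coeff_mul_single_apply, mul_comm]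
      congr 1
      have := h x hx (g * x⁻¹)
      simpa [mul_assoc] using this
    rw [← MonoidAlgebra.sum_coeff_single c, Finsupp.sum, Finset.sum_mul, Finset.mul_sum]
    exact Finset.sum_congr rfl fun x hx => key x (hc x (Finsupp.mem_support_iff.1 hx)) _

theorem IsPrimitiveIdempotent.map {k A : Type*} [CommRing k] [Ring A] [Algebra k A]
    {S T : Subalgebra k A} (φ : A ≃+* A) (h : ∀ a, φ a ∈ T ↔ a ∈ S) {e : A}
    (he : IsPrimitiveIdempotent S e) : IsPrimitiveIdempotent T (φ e) where
  mem := (h e).2 he.mem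
  idem := by rw [← map_mul, he.idem]
  ne_zero := by simpa using he.ne_zero
  eq_zero_or := by
    intro f hf g hg hff hgg hfg hgf hs
    obtain ⟨f, rfl⟩ := φ.surjective f
    obtain ⟨g, rfl⟩ := φ.surjective g
    have h0 : ∀ x, φ x = 0 ↔ x = 0 := fun x => by simp
    rw [← map_mul] at hff hgg hfg hgf
    rw [h0] at hfg hgf
    rw [← map_add] at hs
    rw [h0, h0]
    exact he.eq_zero_or f ((h f).1 hf) g ((h g).1 hg) (φ.injective hff) (φ.injective hgg)
      hfg hgf (φ.injective hs)

/-! ### Brauer pairs -/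

/-- A `kG`-Brauer pair `(P, e)`: a `p`-subgroup `P` of `G` and a block idempotent `e` of
`k C_G(P)`, the latter being regarded as a subalgebra of `kG`. -/
@[ext]
structure BrauerPair (p : ℕ) (k G : Type*) [Field k] [Group G] where
  P : Subgroup G
  e : MonoidAlgebra k G
  isPGroup : IsPGroup p P
  isBlock : IsBlockIdempotent (centralizerAlgebra k P) e

theorem mem_centralizer_conj {G : Type*} [Group G] (Q : Subgroup G) (x g : G) :
    g ∈ Subgroup.centralizer ((MulAut.conj x • Q : Subgroup G) : Set G) ↔
      x⁻¹ * g * x ∈ Subgroup.centralizer (Q : Set G) := by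
  simp only [Subgroup.mem_centralizer_iff, SetLike.mem_coe]
  constructor
  · intro h y hy
    have := h (x * y * x⁻¹) (by
      have := Subgroup.smul_mem_pointwise_smul y (MulAut.conj x) Q hy
      simpa using this)
    calc y * (x⁻¹ * g * x) = x⁻¹ * ((x * y * x⁻¹) * g) * x := by group
      _ = x⁻¹ * (g * (x * y * x⁻¹)) * x := by rw [this]
      _ = _ := by group
  · intro h y hy
    rw [Subgroup.mem_pointwise_smul_iff_inv_smul_mem] at hy
    have h1 := h (x⁻¹ * y * x) (by simpa using hy)
    calc y * g = x * ((x⁻¹ * y * x) * (x⁻¹ * g * x)) * x⁻¹ := by group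
      _ = x * ((x⁻¹ * g * x) * (x⁻¹ * y * x)) * x⁻¹ := by rw [h1]
      _ = _ := by group

theorem conj_mem_centerOf {k G : Type*} [Field k] [Group G] (Q : Subgroup G) (x : G)
    (a : MonoidAlgebra k G) :
    conj k x a ∈ centerOf (centralizerAlgebra k (MulAut.conj x • Q)) ↔
      a ∈ centerOf (centralizerAlgebra k Q) := by
  simp only [mem_centerOf_centralizerAlgebra, mem_centralizer_conj, coeff_conj]
  refine and_congr ⟨fun h g hg => ?_, fun h g hg => h _ hg⟩
    ⟨fun h y hy g => ?_, fun h y hy g => ?_⟩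
  · have := h (x * g * x⁻¹) (by simpa [mul_assoc] using hg)
    simpa [mul_assoc] using this
  · have := h (x * y * x⁻¹) (by simpa [mul_assoc] using hy) (x * g * x⁻¹)
    simpa [mul_assoc] using this
  · have := h _ hy (x⁻¹ * g * x)
    simpa [mul_assoc] using this

namespace BrauerPair

/-- `G` acts on Brauer pairs by conjugation, `x • (P, e) = (x P x⁻¹, c_x(e))`. The stabilizer of
`(P, e)` in `G` under this action is `N_G(P, e)`. -/
instance {p : ℕ} {k G : Type*} [Field k] [Group G] : MulAction G (BrauerPair p k G) where
  smul x X :=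
    { P := MulAut.conj x • X.P
      e := conj k x X.e
      isPGroup := X.isPGroup.map (MulDistribMulAction.toMonoidHom G (MulAut.conj x))
      isBlock := IsPrimitiveIdempotent.map (conj k x).toRingEquiv
        (fun a => conj_mem_centerOf X.P x a) X.isBlock }
  one_smul X := by
    refine BrauerPair.ext ?_ (conj_one X.e)
    change MulAut.conj (1 : G) • X.P = X.P
    simp
  mul_smul x y X := by
    refine BrauerPair.ext ?_ (conj_mul x y X.e)
    change MulAut.conj (x * y) • X.P = MulAut.conj x • MulAut.conj y • X.P
    rw [map_mul, mul_smul]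

/-- An idempotent `i` of `(kG)^P` is associated to `(P, e)` if `e Br_P(i) = Br_P(i) ≠ 0`. -/
def IsAssociated {p : ℕ} {k G : Type*} [Field k] [Group G] (X : BrauerPair p k G)
    (i : MonoidAlgebra k G) : Prop :=
  X.e * brauerMap X.P i = brauerMap X.P i ∧ brauerMap X.P i ≠ 0

/-- `(Q, f) ≤ (P, e)` if `Q ≤ P` and every primitive idempotent of `(kG)^P` that is associated to
`(P, e)` is also associated to `(Q, f)`. -/
instance {p : ℕ} {k G : Type*} [Field k] [Group G] : LE (BrauerPair p k G) where
  le X Y := X.P ≤ Y.P ∧ ∀ i, IsPrimitiveIdempotent (fixedAlgebra k Y.P) i →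
    Y.IsAssociated i → X.IsAssociated i

/-- `(P, e)` is a `(kG, b)`-Brauer pair: `Br_P(b) e = e`. -/
def Belongs {p : ℕ} {k G : Type*} [Field k] [Group G] (b : MonoidAlgebra k G)
    (X : BrauerPair p k G) : Prop :=
  brauerMap X.P b * X.e = X.e

/-- The Brauer pair `({1}, b)` given by a block idempotent `b` of `kG`. -/
def ofBlock (p : ℕ) {k G : Type*} [Field k] [Group G] (b : MonoidAlgebra k G)
    (hb : IsBlockIdempotent (⊤ : Subalgebra k (MonoidAlgebra k G)) b) : BrauerPair p k G where
  P := ⊥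
  e := b
  isPGroup := IsPGroup.of_bot
  isBlock := by
    have : centralizerAlgebra k (⊥ : Subgroup G) = ⊤ := by
      refine eq_top_iff.2 fun a _ g _ => ?_
      simp [Subgroup.mem_centralizer_iff]
    rwa [this]

end BrauerPair

/-! ### The action of the Galois group -/

/-- An automorphism `γ` of `L` over `K` acts on `LG` through the coefficients, as a ring
automorphism. -/
def galRingEquiv {K L : Type*} (G : Type*) [Field K] [Field L] [Algebra K L] [Group G]
    (γ : L ≃ₐ[K] L) : MonoidAlgebra L G ≃+* MonoidAlgebra L G :=
  MonoidAlgebra.mapRingEquiv G γ.toRingEquiv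

/-- This is the coefficientwise action that Mathlib puts on `LG`. -/
theorem galRingEquiv_apply {K L G : Type*} [Field K] [Field L] [Algebra K L] [Group G]
    (γ : L ≃ₐ[K] L) (a : MonoidAlgebra L G) : galRingEquiv G γ a = γ • a := by
  ext g
  simp [galRingEquiv]

theorem gal_mem_centerOf {K L G : Type*} [Field K] [Field L] [Algebra K L] [Group G]
    (Q : Subgroup G) (γ : L ≃ₐ[K] L) (a : MonoidAlgebra L G) :
    galRingEquiv G γ a ∈ centerOf (centralizerAlgebra L Q) ↔
      a ∈ centerOf (centralizerAlgebra L Q) := by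
  simp [mem_centerOf_centralizerAlgebra, galRingEquiv_apply]

namespace BrauerPair

/-- The Galois group `Γ` acts on Brauer pairs by `γ • (P, e) = (P, γ • e)`. -/
instance {p : ℕ} {K L G : Type*} [Field K] [Field L] [Algebra K L] [Group G] :
    MulAction (L ≃ₐ[K] L) (BrauerPair p L G) where
  smul γ X :=
    { P := X.P
      e := γ • X.e
      isPGroup := X.isPGroup
      isBlock := galRingEquiv_apply γ X.e ▸ IsPrimitiveIdempotent.map (galRingEquiv G γ)
        (fun a => gal_mem_centerOf X.P γ a) X.isBlock }
  one_smul X := BrauerPair.ext rfl (one_smul _ X.e)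
  mul_smul γ δ X := BrauerPair.ext rfl (mul_smul γ δ X.e)

instance {p : ℕ} {K L G : Type*} [Field K] [Field L] [Algebra K L] [Group G] :
    SMulCommClass G (L ≃ₐ[K] L) (BrauerPair p L G) where
  smul_comm x γ X := by
    refine BrauerPair.ext rfl ?_
    change conj L x (γ • X.e) = γ • conj L x X.e
    ext g
    simp [coeff_conj]

/-- The resulting action of `G × Γ`, namely `(x, γ) • (P, e) = (x P x⁻¹, c_x(γ • e))`. -/
instance {p : ℕ} {K L G : Type*} [Field K] [Field L] [Algebra K L] [Group G] :
    MulAction (G × (L ≃ₐ[K] L)) (BrauerPair p L G) :=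
  MulAction.prodOfSMulCommClass G (L ≃ₐ[K] L) (BrauerPair p L G)

end BrauerPair

/-! ### Descent of block idempotents to the small field -/

/-- `∑_{γ ∈ [Γ / Γ_e]} γ • e`, the sum of the distinct Galois conjugates of `e`, as an element
of `LG`. -/
def conjugateSum (K : Type*) {L G : Type*} [Field K] [Field L] [Algebra K L] [Group G]
    (e : MonoidAlgebra L G) : MonoidAlgebra L G :=
  ∑ᶠ q : (L ≃ₐ[K] L) ⧸ MulAction.stabilizer (L ≃ₐ[K] L) e,
    MulAction.ofQuotientStabilizer (L ≃ₐ[K] L) e q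

theorem smul_conjugateSum {K L G : Type*} [Field K] [Field L] [Algebra K L]
    [FiniteDimensional K L] [Group G] (e : MonoidAlgebra L G) (γ : L ≃ₐ[K] L) :
    γ • conjugateSum K e = conjugateSum K e := by
  classical
  have := Fintype.ofFinite ((L ≃ₐ[K] L) ⧸ MulAction.stabilizer (L ≃ₐ[K] L) e)
  rw [conjugateSum, finsum_eq_sum_of_fintype, Finset.smul_sum]
  simp_rw [← MulAction.ofQuotientStabilizer_smul]
  exact Equiv.sum_comp (MulAction.toPerm γ) _

theorem mapRingHom_injective (K L G : Type*) [Field K] [Field L] [Algebra K L] [Group G] :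
    Function.Injective (MonoidAlgebra.mapRingHom G (algebraMap K L)) := by
  intro a b h
  ext g
  have := congrArg (fun c => c.coeff g) h
  simpa using this

theorem exists_descent {K L G : Type*} [Field K] [Field L] [Algebra K L]
    [FiniteDimensional K L] [IsGalois K L] [Group G] (e : MonoidAlgebra L G) :
    ∃ a : MonoidAlgebra K G,
      MonoidAlgebra.mapRingHom G (algebraMap K L) a = conjugateSum K e := by
  classical
  have h : ∀ g, ∃ r : K, algebraMap K L r = (conjugateSum K e).coeff g := by
    intro g
    refine (IsGalois.mem_range_algebraMap_iff_fixed _).2 fun γ => ?_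
    have := congrArg (fun c => c.coeff g) (smul_conjugateSum e γ)
    simpa [MonoidAlgebra.coeff_smul_apply] using this
  choose r hr using h
  refine ⟨MonoidAlgebra.ofCoeff
    (Finsupp.onFinset (conjugateSum K e).coeff.support r fun g hg => ?_), ?_⟩
  · rw [Finsupp.mem_support_iff, ← hr g]
    simpa using hg
  · ext g
    simp [hr]

/-- The element `ẽ = ∑_{γ ∈ [Γ / Γ_e]} γ • e` of `KG`. -/
def descent (K : Type*) {L G : Type*} [Field K] [Field L] [Algebra K L]
    [FiniteDimensional K L] [IsGalois K L] [Group G] (e : MonoidAlgebra L G) :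
    MonoidAlgebra K G :=
  (exists_descent (K := K) e).choose

theorem mapRingHom_descent {K L G : Type*} [Field K] [Field L] [Algebra K L]
    [FiniteDimensional K L] [IsGalois K L] [Group G] (e : MonoidAlgebra L G) :
    MonoidAlgebra.mapRingHom G (algebraMap K L) (descent K e) = conjugateSum K e :=
  (exists_descent (K := K) e).choose_spec

theorem mapRingHom_mem_centerOf {K L G : Type*} [Field K] [Field L] [Algebra K L] [Group G]
    (Q : Subgroup G) (a : MonoidAlgebra K G) :
    MonoidAlgebra.mapRingHom G (algebraMap K L) a ∈ centerOf (centralizerAlgebra L Q) ↔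
      a ∈ centerOf (centralizerAlgebra K Q) := by
  simp [mem_centerOf_centralizerAlgebra]

theorem centerOf_comm {k A : Type*} [CommRing k] [Ring A] [Algebra k A] {S : Subalgebra k A}
    {a b : A} (ha : a ∈ centerOf S) (hb : b ∈ centerOf S) : a * b = b * a :=
  (Subalgebra.mem_centralizer_iff k).1 hb.2 a ha.1

/-- A block idempotent `e` satisfies `c e = 0` or `c e = e` for every central idempotent `c`. -/
theorem IsBlockIdempotent.mul_eq {k A : Type*} [CommRing k] [Ring A] [Algebra k A]
    {S : Subalgebra k A} {e c : A} (he : IsBlockIdempotent S e) (hc : c ∈ centerOf S)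
    (hcc : c * c = c) : c * e = 0 ∨ c * e = e := by
  have hce := centerOf_comm hc he.mem
  have h1 : c * e * (c * e) = c * e := by
    rw [mul_assoc, ← mul_assoc e, ← hce, mul_assoc c e, he.idem, ← mul_assoc, hcc]
  have h2 : c * e * e = c * e := by rw [mul_assoc, he.idem]
  have h3 : e * (c * e) = c * e := by rw [← mul_assoc, ← hce, h2]
  have := he.eq_zero_or (c * e) (mul_mem hc he.mem) (e - c * e)
    (sub_mem he.mem (mul_mem hc he.mem)) h1
    (by rw [sub_mul, mul_sub, mul_sub, he.idem, h1, h2, h3]; abel)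
    (by rw [mul_sub, h1, h2, sub_self]) (by rw [sub_mul, h1, h3, sub_self]) (by abel)
  rcases this with h | h
  · exact Or.inl h
  · exact Or.inr (sub_eq_zero.1 h).symm

theorem IsBlockIdempotent.mul_eq_zero {k A : Type*} [CommRing k] [Ring A] [Algebra k A]
    {S : Subalgebra k A} {e f : A} (he : IsBlockIdempotent S e) (hf : IsBlockIdempotent S f)
    (hef : e ≠ f) : e * f = 0 := by
  rcases hf.mul_eq he.mem he.idem with h | h
  · exact h
  rcases he.mul_eq hf.mem hf.idem with h' | h'
  · rw [centerOf_comm he.mem hf.mem, h']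
  · exact absurd (by rw [← h', ← centerOf_comm he.mem hf.mem, h]) hef

/-- If `e` is a block idempotent of `L C_G(Q)`, then `ẽ` is a block idempotent of `K C_G(Q)`. -/
theorem isBlockIdempotent_descent {K L G : Type*} [Field K] [Field L] [Algebra K L]
    [FiniteDimensional K L] [IsGalois K L] [Group G] (Q : Subgroup G) {e : MonoidAlgebra L G}
    (he : IsBlockIdempotent (centralizerAlgebra L Q) e) :
    IsBlockIdempotent (centralizerAlgebra K Q) (descent K e) := by
  classical
  have := Fintype.ofFinite ((L ≃ₐ[K] L) ⧸ MulAction.stabilizer (L ≃ₐ[K] L) e)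
  set m := MonoidAlgebra.mapRingHom G (algebraMap K L) with hm
  have minj : Function.Injective m := mapRingHom_injective K L G
  set c : (L ≃ₐ[K] L) ⧸ MulAction.stabilizer (L ≃ₐ[K] L) e → MonoidAlgebra L G :=
    MulAction.ofQuotientStabilizer (L ≃ₐ[K] L) e with hc
  have cinj : Function.Injective c := MulAction.injective_ofQuotientStabilizer _ _
  have hsum : m (descent K e) = ∑ q, c q := by
    rw [hm, mapRingHom_descent, conjugateSum, finsum_eq_sum_of_fintype]
  have hcg : ∀ q, ∃ γ : L ≃ₐ[K] L, c q = galRingEquiv G γ e := by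
    intro q
    obtain ⟨γ, rfl⟩ := QuotientGroup.mk_surjective q
    exact ⟨γ, by rw [galRingEquiv_apply]; rfl⟩
  have hcb : ∀ q, IsBlockIdempotent (centralizerAlgebra L Q) (c q) := by
    intro q
    obtain ⟨γ, hγ⟩ := hcg q
    rw [hγ]
    exact IsPrimitiveIdempotent.map _ (fun a => gal_mem_centerOf Q γ a) he
  have hcm : ∀ q, c q * ∑ r, c r = c q := by
    intro q
    rw [Finset.mul_sum, Finset.sum_eq_single q, (hcb q).idem]
    · intro r _ hr
      exact (hcb q).mul_eq_zero (hcb r) (fun h => hr (cinj h).symm)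
    · simp
  have hc1 : c (QuotientGroup.mk 1) = e := by
    rw [hc, MulAction.ofQuotientStabilizer_mk, one_smul]
  have mfix : ∀ (γ : L ≃ₐ[K] L) a, galRingEquiv G γ (m a) = m a := by
    intro γ a
    rw [galRingEquiv_apply]
    ext g
    simp [hm]
  refine ⟨?_, ?_, ?_, ?_⟩
  · rw [← mapRingHom_mem_centerOf (L := L), ← hm, hsum]
    exact sum_mem fun q _ => (hcb q).mem
  · apply minj
    rw [map_mul, hsum, Finset.sum_mul]
    exact Finset.sum_congr rfl fun q _ => hcm q
  · intro h
    have := hcm (QuotientGroup.mk 1)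
    rw [← hsum, h, map_zero, mul_zero, hc1] at this
    exact he.ne_zero this.symm
  · have key : ∀ f ∈ centerOf (centralizerAlgebra K Q), ∀ g : MonoidAlgebra K G,
        f * g = 0 → f * f = f → descent K e = f + g → m f * e = 0 → f = 0 := by
      intro f hf g hfg hff hs h0
      have h1 : ∀ q, m f * c q = 0 := by
        intro q
        obtain ⟨γ, hγ⟩ := hcg q
        rw [hγ, ← mfix γ f, ← map_mul, h0, map_zero]
      have h2 : f * descent K e = f := by rw [hs, mul_add, hfg, hff, add_zero]
      apply minj
      rw [map_zero, ← h2, map_mul, hsum, Finset.mul_sum]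
      exact Finset.sum_eq_zero fun q _ => h1 q
    intro f hf g hg hff hgg hfg hgf hs
    have hmf := (mapRingHom_mem_centerOf (L := L) Q f).2 hf
    rcases he.mul_eq hmf (by rw [← map_mul, hff]) with h | h
    · exact Or.inl (key f hf g hfg hff hs h)
    · refine Or.inr (key g hg f hgf hgg (by rw [hs, add_comm]) ?_)
      rw [← h, ← mul_assoc, hm, ← map_mul, hgf, map_zero, zero_mul]

/-- The `KG`-Brauer pair `(P, ẽ)` of an `LG`-Brauer pair `(P, e)`. -/
def BrauerPair.descend (K : Type*) {L G : Type*} {p : ℕ} [Field K] [Field L] [Algebra K L]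
    [FiniteDimensional K L] [IsGalois K L] [Group G] (X : BrauerPair p L G) :
    BrauerPair p K G where
  P := X.P
  e := descent K X.e
  isPGroup := X.isPGroup
  isBlock := isBlockIdempotent_descent X.P X.isBlock

/-- The field `K(a)` obtained by adjoining to `K` the coefficients of `a ∈ LG`. -/
def coeffField (K : Type*) {L G : Type*} [Field K] [Field L] [Algebra K L] [Group G]
    (a : MonoidAlgebra L G) : IntermediateField K L :=
  IntermediateField.adjoin K (Set.range fun g => a.coeff g)

end BlockTheory

end

open BlockTheory MulAction

/-! A Brauer pair contains at most one pair with a given first component and belongs to only one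
block (`eq_of_le_of_le`, `eq_of_belongs`). The Galois group respects containment and membership, so
an automorphism that fixes a pair fixes every smaller pair and the block. This is (a).

In (b) only the projections need an argument. If `x` fixes `(P, ẽ)`, then `c_x(e)` is one of the
Galois conjugates that make up `ẽ`, so some `γ` compensates `x` (`map_fst_stabilizer`). If `γ` fixes
`b`, then `γ(P, e)` is again maximal for `b`, hence `G`-conjugate to `(P, e)`, so some `x`
compensates `γ` (`map_snd_stabilizer`).

The conjugacy of maximal pairs (`mem_orbit_of_maximal`) rests on the sum `s` of the
`N_G(P)`-conjugates of `e`. Maximality makes `P` a Sylow subgroup of `C_G(g)` for every `g` in the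
support of `s`. A fusion argument then shows `s = Br_P(z)` with `z` central in `kG`. Since `e s =
e`, the element `zb` is not nilpotent, and locality of `Z(kG)b` gives `b = zw`. For another maximal
pair `(Q, f)` it follows that `Br_Q(z) f ≠ 0`, which forces a conjugate of `Q` into `P`. By symmetry
the orders agree; once `Q = P`, the block `f` meets a summand of `s` and equals it.

For (c), Goursat's lemma gives the isomorphism of quotients, and the Galois correspondence
identifies `Γ_b/Γ_e` with the group of `K(e)/K(b)`. It is cyclic because the coefficientwise
Frobenius map permutes the finitely many central idempotents of `LC_G(P)`: the coefficients of `e`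
lie in a finite field. -/

namespace BlockTheory

/-! ### Primitive idempotents in finite-dimensional algebras -/

section Idempotents

variable {k A : Type*} [Field k] [Ring A] [Algebra k A] {S : Subalgebra k A}

/-- The local ring property of `i S i` for a primitive idempotent `i` of `S`. -/
theorem IsPrimitiveIdempotent.isNilpotent_or_exists_inverse [FiniteDimensional k A] {i z : A}
    (hi : IsPrimitiveIdempotent S i) (hz : z ∈ S) (hiz : i * z = z) (hzi : z * i = z) :
    IsNilpotent z ∨ ∃ w ∈ S, z * w = i := by
  open Polynomial in
  have hint : IsIntegral k z := Algebra.IsIntegral.isIntegral z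
  obtain ⟨n, q, hq, hXq⟩ : ∃ n q, minpoly k z = X ^ n * q ∧ ¬X ∣ q := by
    obtain ⟨q, hq, hXq⟩ := exists_eq_pow_rootMultiplicity_mul_and_not_dvd (minpoly k z)
      (minpoly.ne_zero hint) 0
    rw [C_0, sub_zero] at hq hXq
    exact ⟨_, q, hq, hXq⟩
  -- This is Fitting's decomposition for `z`. The exponent `n + 1` instead of `n` guarantees a
  -- factor `z` in the idempotent `u(z) z ^ (n + 1)`, so that it lies in `i S i` even when `n = 0`.
  have hcop : IsCoprime (X ^ (n + 1)) q :=
    IsCoprime.pow_left ((irreducible_X.coprime_iff_not_dvd).2 hXq)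
  obtain ⟨u, v, huv⟩ := hcop
  have hmem : ∀ r : k[X], aeval z r ∈ S := fun r => by
    have := (aeval (⟨z, hz⟩ : S) r).2
    rwa [← S.coe_val, ← aeval_algHom_apply] at this
  have h0 : aeval z (X ^ (n + 1) * q) = 0 := by
    rw [pow_succ', mul_assoc, ← hq, map_mul, minpoly.aeval, mul_zero]
  have hE : aeval z (u * X ^ (n + 1)) * aeval z (u * X ^ (n + 1)) =
      aeval z (u * X ^ (n + 1)) := by
    have : u * X ^ (n + 1) * (u * X ^ (n + 1)) =
        u * X ^ (n + 1) - u * v * (X ^ (n + 1) * q) := by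
      linear_combination (u * X ^ (n + 1)) * huv
    rw [← map_mul, this, map_sub, map_mul _ (u * v), h0, mul_zero, sub_zero]
  have hEi : aeval z (u * X ^ (n + 1)) * i = aeval z (u * X ^ (n + 1)) := by
    rw [pow_succ, ← mul_assoc, map_mul, aeval_X, mul_assoc, hzi]
  have hiE : i * aeval z (u * X ^ (n + 1)) = aeval z (u * X ^ (n + 1)) := by
    rw [pow_succ', mul_comm u, mul_assoc, map_mul, aeval_X, ← mul_assoc, hiz]
  rcases hi.eq_zero_or (aeval z (u * X ^ (n + 1))) (hmem _) (i - aeval z (u * X ^ (n + 1)))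
    (sub_mem hi.mem (hmem _)) hE (by rw [sub_mul, mul_sub, mul_sub, hE, hEi, hiE, hi.idem]; abel)
    (by rw [mul_sub, hE, hEi, sub_self]) (by rw [sub_mul, hE, hiE, sub_self]) (by abel) with h | h
  · refine Or.inl ⟨n + 1, ?_⟩
    have : (X : k[X]) ^ (n + 1) = X ^ (n + 1) * (u * X ^ (n + 1)) + v * (X ^ (n + 1) * q) := by
      linear_combination (-X ^ (n + 1)) * huv
    have h1 := congrArg (aeval z) this
    rw [map_add, map_mul, h, map_mul, h0] at h1
    simpa using h1
  · refine Or.inr ⟨aeval z (u * X ^ n), hmem _, ?_⟩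
    calc z * aeval z (u * X ^ n) = aeval z (X * (u * X ^ n)) := by
          rw [map_mul (aeval z) X, aeval_X]
      _ = aeval z (u * X ^ (n + 1)) := by congr 1; ring
      _ = i := (sub_eq_zero.1 h).symm

/-- An idempotent of `S` that a ring homomorphism does not kill has a primitive summand with the
same property. -/
theorem exists_isPrimitiveIdempotent_map_ne_zero [FiniteDimensional k A] {B : Type*} [Ring B]
    (φ : S →+* B) {c : S} (hc : c * c = c) (hc0 : φ c ≠ 0) :
    ∃ i : S, IsPrimitiveIdempotent S (i : A) ∧ c * i = i ∧ φ i ≠ 0 := by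
  -- Choose among the surviving idempotents under `c` one whose right ideal `i S` has least
  -- dimension. In a decomposition `i = f + g` one summand survives, and minimality forces `f S = i
  -- S`, hence `g = 0`.
  let T : Set S := {i | i * i = i ∧ φ i ≠ 0 ∧ c * i = i}
  have hT : T.Nonempty := ⟨c, hc, hc0, hc⟩
  let d : S → ℕ := fun i => Module.finrank k (LinearMap.range (LinearMap.mulLeft k i))
  obtain ⟨⟨hi, hi0, hci⟩, hmin⟩ := Function.isMinimalFor_argminOn d T hT
  set i := Function.argminOn d T hT
  have key : ∀ f g : S, f * f = f → f * g = 0 → g * f = 0 → i = f + g → φ f ≠ 0 → g = 0 := by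
    intro f g hff hfg hgf hs hf0
    have hfi : i * f = f := by rw [hs, add_mul, hff, hgf, add_zero]
    have hif : f * i = f := by rw [hs, mul_add, hff, hfg, add_zero]
    have hfT : f ∈ T := ⟨hff, hf0, by rw [← hfi, ← mul_assoc, hci]⟩
    have hle : LinearMap.range (LinearMap.mulLeft k f) ≤
        LinearMap.range (LinearMap.mulLeft k i) := by
      rintro _ ⟨y, rfl⟩
      exact ⟨f * y, by simp [← mul_assoc, hfi]⟩
    have heq := Submodule.eq_of_le_of_finrank_le hle (hmin hfT (Submodule.finrank_mono hle))
    obtain ⟨y, hy⟩ : i ∈ LinearMap.range (LinearMap.mulLeft k f) := heq ▸ ⟨1, by simp⟩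
    have : f * i = i := by rw [← hy, LinearMap.mulLeft_apply, ← mul_assoc, hff]
    rw [hif] at this
    rw [← this] at hs
    simpa using hs.symm
  refine ⟨i, ⟨i.2, congrArg Subtype.val hi, fun h => hi0 ?_, ?_⟩, hci, hi0⟩
  · rw [show i = 0 from Subtype.ext h, map_zero]
  intro f hf g hg hff hgg hfg hgf hs
  lift f to S using hf
  lift g to S using hg
  norm_cast at hff hgg hfg hgf hs ⊢
  by_cases hf0 : φ f = 0
  · refine Or.inl (key g f hgg hgf hfg (by rw [hs, add_comm]) fun hg0 => hi0 ?_)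
    rw [hs, map_add, hf0, hg0, add_zero]
  · exact Or.inr (key f g hff hfg hgf hs hf0)

/-- A multiplicative map sends a primitive idempotent `i` to an element which any idempotent
commuting with it either kills or fixes. -/
theorem IsPrimitiveIdempotent.map_mul_eq [FiniteDimensional k A] {B : Type*} [Ring B] {i e : A}
    (hi : IsPrimitiveIdempotent S i) (φ : S →+* B) (he : e ∈ S)
    (hee : φ ⟨e, he⟩ * φ ⟨e, he⟩ = φ ⟨e, he⟩)
    (hcomm : φ ⟨e, he⟩ * φ ⟨i, hi.mem⟩ = φ ⟨i, hi.mem⟩ * φ ⟨e, he⟩) :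
    φ ⟨e, he⟩ * φ ⟨i, hi.mem⟩ = 0 ∨ φ ⟨e, he⟩ * φ ⟨i, hi.mem⟩ = φ ⟨i, hi.mem⟩ := by
  set e' : S := ⟨e, he⟩
  set i' : S := ⟨i, hi.mem⟩
  have hi' : i' * i' = i' := Subtype.ext hi.idem
  have hφi : φ i' * φ i' = φ i' := by rw [← map_mul, hi']
  have hφ : φ (i' * e' * i') = φ e' * φ i' := by
    rw [map_mul, map_mul, ← hcomm, mul_assoc, hφi]
  have hidem : φ (i' * e' * i') * φ (i' * e' * i') = φ (i' * e' * i') := by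
    rw [hφ, mul_assoc, ← mul_assoc (φ i'), ← hcomm, mul_assoc, hφi, ← mul_assoc, hee]
  -- The element `i e i` of the local ring `i S i` has the idempotent image `φ(e) φ(i)`. If it is
  -- nilpotent, this idempotent is zero; if it is invertible, `φ(e)` fixes `φ(i)`.
  rcases hi.isNilpotent_or_exists_inverse (i' * e' * i').2
    (by simp [i', ← mul_assoc, hi.idem]) (by simp [i', mul_assoc, hi.idem]) with ⟨n, hn⟩ | ⟨w, hw, h⟩
  · left
    have hn' : (i' * e' * i') ^ (n + 1) = 0 := by
      rw [pow_succ, show (i' * e' * i') ^ n = 0 from Subtype.ext hn, zero_mul]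
    rw [← hφ, ← IsIdempotentElem.pow_succ_eq n hidem, ← map_pow, hn', map_zero]
  · right
    have h' : i' * e' * i' * ⟨w, hw⟩ = i' := Subtype.ext h
    have h1 := congrArg φ h'
    rw [map_mul, hφ] at h1
    rw [← h1, ← mul_assoc, ← mul_assoc, hee]

end Idempotents

/-! ### Orbit counting modulo `p` -/

/-- In characteristic `p`, only the fixed points of a `p`-group contribute to the sum of an
invariant function. -/
theorem sum_eq_sum_fixedPoints {p : ℕ} [Fact p.Prime] {k P α : Type*} [Field k] [CharP k p]
    [Group P] [MulAction P α] (hP : IsPGroup p P) (s : Finset α)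
    (hs : ∀ (x : P), ∀ a ∈ s, x • a ∈ s) (f : α → k) (hf : ∀ (x : P), ∀ a ∈ s, f (x • a) = f a)
    [DecidablePred (· ∈ fixedPoints P α)] :
    ∑ a ∈ s, f a = ∑ a ∈ s with a ∈ fixedPoints P α, f a := by
  classical
  rw [← Finset.sum_filter_add_sum_filter_not s (· ∈ fixedPoints P α), add_eq_left]
  -- Group the non-fixed points by the value of `f`. Each fibre is stable under `P` and has no fixed
  -- point, so its size is divisible by `p` and it contributes zero.
  have := Finset.sum_comp (s := s.filter (· ∉ fixedPoints P α)) (f := id) (g := f)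
  simp only [id] at this
  rw [this]
  refine Finset.sum_eq_zero fun v _ => ?_
  rw [nsmul_eq_mul]
  convert zero_mul v
  rw [CharP.cast_eq_zero_iff k p]
  set t := {a ∈ {a ∈ s | a ∉ fixedPoints P α} | f a = v} with ht
  let T : SubMulAction P α :=
    { carrier := t
      smul_mem' := by
        intro x a ha
        simp only [ht, Finset.coe_filter, Finset.mem_filter, Set.mem_ofPred_eq] at ha ⊢
        refine ⟨⟨hs x a ha.1.1, fun h => ha.1.2 ?_⟩, by rw [hf x a ha.1.1, ha.2]⟩
        have h1 := h x⁻¹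
        rw [inv_smul_smul] at h1
        rw [h1]
        exact h }
  have hT : Nat.card T = t.card := by
    change Nat.card (t : Set α) = _
    simp
  have : Finite T := t.finite_toSet
  have h1 := hP.card_modEq_card_fixedPoints T
  have h2 : IsEmpty (fixedPoints P T) := by
    refine ⟨fun a => ?_⟩
    have h3 : a.1.1 ∈ t := a.1.2
    simp only [ht, Finset.mem_filter] at h3
    exact h3.1.2 fun x => congrArg Subtype.val (a.2 x)
  rw [Nat.card_of_isEmpty (α := fixedPoints P T), hT] at h1
  exact (Nat.modEq_zero_iff_dvd).1 h1

/-! ### The Brauer homomorphism -/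

section BrauerMap

variable {k G : Type*} [Field k] [Group G] {P Q : Subgroup G}

theorem coeff_brauerMap_of_mem (a : MonoidAlgebra k G) {g : G}
    (hg : g ∈ Subgroup.centralizer (P : Set G)) : (brauerMap P a).coeff g = a.coeff g := by
  classical
  simp only [brauerMap, MonoidAlgebra.coeff_ofCoeff, Finsupp.filter_apply]
  exact if_pos hg

theorem coeff_brauerMap_of_notMem (a : MonoidAlgebra k G) {g : G}
    (hg : g ∉ Subgroup.centralizer (P : Set G)) : (brauerMap P a).coeff g = 0 := by
  classical
  simp only [brauerMap, MonoidAlgebra.coeff_ofCoeff, Finsupp.filter_apply]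
  exact if_neg hg

theorem brauerMap_mem (P : Subgroup G) (a : MonoidAlgebra k G) :
    brauerMap P a ∈ centralizerAlgebra k P := by
  intro g hg
  by_contra h
  exact hg (coeff_brauerMap_of_notMem a h)

theorem brauerMap_eq_self {a : MonoidAlgebra k G} (ha : a ∈ centralizerAlgebra k P) :
    brauerMap P a = a := by
  ext g
  by_cases hg : g ∈ Subgroup.centralizer (P : Set G)
  · exact coeff_brauerMap_of_mem a hg
  · rw [coeff_brauerMap_of_notMem a hg]
    by_contra h
    exact hg (ha g (Ne.symm h))

theorem brauerMap_zero (P : Subgroup G) : brauerMap P (0 : MonoidAlgebra k G) = 0 :=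
  brauerMap_eq_self (zero_mem _)

theorem brauerMap_one (P : Subgroup G) : brauerMap P (1 : MonoidAlgebra k G) = 1 :=
  brauerMap_eq_self (one_mem _)

theorem brauerMap_add (P : Subgroup G) (a b : MonoidAlgebra k G) :
    brauerMap P (a + b) = brauerMap P a + brauerMap P b := by
  ext g
  by_cases hg : g ∈ Subgroup.centralizer (P : Set G)
  · simp [coeff_brauerMap_of_mem _ hg]
  · simp [coeff_brauerMap_of_notMem _ hg]

theorem centralizer_antitone (hPQ : P ≤ Q) :
    Subgroup.centralizer (Q : Set G) ≤ Subgroup.centralizer (P : Set G) :=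
  Subgroup.centralizer_le hPQ

theorem brauerMap_brauerMap (hPQ : P ≤ Q) (a : MonoidAlgebra k G) :
    brauerMap Q (brauerMap P a) = brauerMap Q a := by
  ext g
  by_cases hg : g ∈ Subgroup.centralizer (Q : Set G)
  · rw [coeff_brauerMap_of_mem _ hg, coeff_brauerMap_of_mem _ hg,
      coeff_brauerMap_of_mem _ (centralizer_antitone hPQ hg)]
  · rw [coeff_brauerMap_of_notMem _ hg, coeff_brauerMap_of_notMem _ hg]

theorem conj_brauerMap (P : Subgroup G) (x : G) (a : MonoidAlgebra k G) :
    conj k x (brauerMap P a) = brauerMap (MulAut.conj x • P) (conj k x a) := by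
  ext g
  rw [coeff_conj]
  by_cases hg : x⁻¹ * g * x ∈ Subgroup.centralizer (P : Set G)
  · rw [coeff_brauerMap_of_mem _ hg,
      coeff_brauerMap_of_mem _ ((mem_centralizer_conj P x g).2 hg), coeff_conj]
  · rw [coeff_brauerMap_of_notMem _ hg,
      coeff_brauerMap_of_notMem _ fun h => hg ((mem_centralizer_conj P x g).1 h)]

theorem smul_brauerMap {K : Type*} [Field K] [Algebra K k] (P : Subgroup G) (γ : k ≃ₐ[K] k)
    (a : MonoidAlgebra k G) : γ • brauerMap P a = brauerMap P (γ • a) := by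
  ext g
  rw [MonoidAlgebra.coeff_smul_apply]
  by_cases hg : g ∈ Subgroup.centralizer (P : Set G)
  · rw [coeff_brauerMap_of_mem _ hg, coeff_brauerMap_of_mem _ hg, MonoidAlgebra.coeff_smul_apply]
  · rw [coeff_brauerMap_of_notMem _ hg, coeff_brauerMap_of_notMem _ hg, smul_zero]

theorem fixedAlgebra_antitone (hPQ : P ≤ Q) : fixedAlgebra k Q ≤ fixedAlgebra k P :=
  fun _ ha x hx => ha x (hPQ hx)

theorem coeff_conj_of_mem_fixedAlgebra {a : MonoidAlgebra k G} (ha : a ∈ fixedAlgebra k P) {x : G}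
    (hx : x ∈ P) (g : G) : a.coeff (x * g * x⁻¹) = a.coeff g := by
  have := congrArg (fun c => c.coeff (x * g * x⁻¹)) (ha x hx)
  simp only [coeff_conj] at this
  rw [← this]
  congr 1
  group

theorem centralizerAlgebra_le_fixedAlgebra (P : Subgroup G) :
    centralizerAlgebra k P ≤ fixedAlgebra k P := by
  intro a ha x hx
  ext g
  rw [coeff_conj]
  by_cases hg : g ∈ Subgroup.centralizer (P : Set G)
  · congr 1
    rw [mul_assoc, ← hg x hx, inv_mul_cancel_left]
  · rw [show a.coeff g = 0 by by_contra h; exact hg (ha g h)]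
    by_contra h
    have h1 := ha _ h x hx
    apply hg
    have h2 : x⁻¹ * g * x = g := by
      have := congrArg (fun y => y * x⁻¹) h1
      simp only [mul_assoc, mul_inv_cancel_left, mul_inv_cancel, mul_one] at this
      rw [mul_assoc, ← this]
    rw [← h2]
    exact ha _ h

theorem conj_smul_eq_self_of_le_normalizer {H : Subgroup G} (h : H ≤ Subgroup.normalizer P) {x : G}
    (hx : x ∈ H) : MulAut.conj x • P = P := by
  ext g
  rw [Subgroup.mem_pointwise_smul_iff_inv_smul_mem]
  have := (Subgroup.mem_normalizer_iff.1 (inv_mem (h hx))) g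
  simpa using this.symm

theorem brauerMap_mem_fixedAlgebra (hQ : Q ≤ Subgroup.normalizer P) {a : MonoidAlgebra k G}
    (ha : a ∈ fixedAlgebra k Q) : brauerMap P a ∈ fixedAlgebra k Q := by
  intro x hx
  rw [conj_brauerMap, conj_smul_eq_self_of_le_normalizer hQ hx, ha x hx]

theorem centralizerAlgebra_bot : centralizerAlgebra k (⊥ : Subgroup G) = ⊤ := by
  refine eq_top_iff.2 fun a _ g _ => ?_
  simp [Subgroup.mem_centralizer_iff]

theorem mem_centerOf_top {a : MonoidAlgebra k G} :
    a ∈ centerOf (⊤ : Subalgebra k (MonoidAlgebra k G)) ↔ a ∈ fixedAlgebra k (⊤ : Subgroup G) := by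
  rw [← centralizerAlgebra_bot, mem_centerOf_centralizerAlgebra]
  have hc : Subgroup.centralizer ((⊥ : Subgroup G) : Set G) = ⊤ := by
    simp [Subgroup.eq_top_iff', Subgroup.mem_centralizer_iff]
  simp only [hc, Subgroup.mem_top, implies_true, true_and, forall_const]
  refine ⟨fun h x _ => ?_, fun h x g => ?_⟩
  · ext g
    rw [coeff_conj, h]
  · simpa using coeff_conj_of_mem_fixedAlgebra h (Subgroup.mem_top x⁻¹) g

theorem fixedAlgebra_le_of_mem_centerOf {a : MonoidAlgebra k G}
    (ha : a ∈ centerOf (⊤ : Subalgebra k (MonoidAlgebra k G))) (P : Subgroup G) :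
    a ∈ fixedAlgebra k P :=
  fixedAlgebra_antitone le_top (mem_centerOf_top.1 ha)

theorem brauerMap_mem_centerOf (hPQ : P ≤ Q) {a : MonoidAlgebra k G}
    (ha : a ∈ centerOf (centralizerAlgebra k P)) :
    brauerMap Q a ∈ centerOf (centralizerAlgebra k Q) := by
  refine mem_centerOf_centralizerAlgebra.2 ⟨brauerMap_mem Q a, fun x hx g => ?_⟩
  have h := (mem_centerOf_centralizerAlgebra.1 ha).2 x (centralizer_antitone hPQ hx) g
  by_cases hg : g ∈ Subgroup.centralizer (Q : Set G)
  · rw [coeff_brauerMap_of_mem _ hg, coeff_brauerMap_of_mem _ (mul_mem (mul_mem (inv_mem hx) hg) hx),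
      h]
  · rw [coeff_brauerMap_of_notMem _ hg, coeff_brauerMap_of_notMem]
    intro h'
    apply hg
    have := mul_mem (mul_mem hx h') (inv_mem hx)
    simpa [mul_assoc] using this

theorem brauerMap_mem_centerOf_of_top {a : MonoidAlgebra k G}
    (ha : a ∈ centerOf (⊤ : Subalgebra k (MonoidAlgebra k G))) (Q : Subgroup G) :
    brauerMap Q a ∈ centerOf (centralizerAlgebra k Q) :=
  brauerMap_mem_centerOf (P := ⊥) bot_le (by rwa [centralizerAlgebra_bot])

variable {p : ℕ} [Fact p.Prime] [CharP k p] [Finite G]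

/-- The Brauer map is multiplicative on the fixed points of a `p`-group. -/
theorem brauerMap_mul (hP : IsPGroup p P) {a b : MonoidAlgebra k G} (ha : a ∈ fixedAlgebra k P)
    (hb : b ∈ fixedAlgebra k P) : brauerMap P (a * b) = brauerMap P a * brauerMap P b := by
  classical
  have := Fintype.ofFinite G
  have key : ∀ (c d : MonoidAlgebra k G) (g : G),
      (c * d).coeff g = ∑ x, c.coeff x * d.coeff (x⁻¹ * g) := fun c d g => by
    rw [MonoidAlgebra.coeff_mul_apply_left, Finsupp.sum_fintype]
    simp
  ext g
  by_cases hg : g ∈ Subgroup.centralizer (P : Set G)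
  · rw [coeff_brauerMap_of_mem _ hg, key, key]
    -- Let `P` act by conjugation on the summation variable of the convolution. As `g` centralizes
    -- `P`, the summand is invariant, and only the terms with `x` in `C_G(P)` remain.
    let : MulAction P G := MulAction.compHom G (MulAut.conj.comp P.subtype)
    have hsmul : ∀ (x : P) (y : G), x • y = x * y * (x : G)⁻¹ := fun _ _ => rfl
    rw [sum_eq_sum_fixedPoints hP Finset.univ (fun _ _ _ => Finset.mem_univ _)
      (fun x => a.coeff x * b.coeff (x⁻¹ * g))]
    · rw [Finset.sum_filter]
      refine Finset.sum_congr rfl fun x _ => ?_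
      have hx : x ∈ fixedPoints P G ↔ x ∈ Subgroup.centralizer (P : Set G) := by
        simp only [mem_fixedPoints, hsmul, mul_inv_eq_iff_eq_mul, Subgroup.mem_centralizer_iff,
          Subtype.forall, SetLike.mem_coe]
      by_cases h : x ∈ Subgroup.centralizer (P : Set G)
      · rw [if_pos (hx.2 h), coeff_brauerMap_of_mem _ h,
          coeff_brauerMap_of_mem _ (mul_mem (inv_mem h) hg)]
      · rw [if_neg (fun h' => h (hx.1 h')), coeff_brauerMap_of_notMem _ h, zero_mul]
    · intro x y _
      simp only [hsmul]
      rw [coeff_conj_of_mem_fixedAlgebra ha x.2]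
      congr 1
      have h1 := hg x x.2
      rw [← coeff_conj_of_mem_fixedAlgebra hb x.2 (y⁻¹ * g)]
      congr 1
      have h2 : (x : G)⁻¹ * g = g * (x : G)⁻¹ := by
        rw [inv_mul_eq_iff_eq_mul, ← mul_assoc, h1, mul_inv_cancel_right]
      rw [mul_inv_rev, mul_inv_rev, inv_inv]
      simp only [mul_assoc, h2]
  · rw [coeff_brauerMap_of_notMem _ hg]
    by_contra h
    exact hg (mul_mem (brauerMap_mem P a) (brauerMap_mem P b) g (Ne.symm h))

/-- The Brauer homomorphism on the fixed points of a `p`-group. -/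
noncomputable def brauerHom (k : Type*) [Field k] [CharP k p] (hP : IsPGroup p P) :
    fixedAlgebra k P →+* MonoidAlgebra k G where
  toFun a := brauerMap P a
  map_one' := brauerMap_one P
  map_mul' a b := brauerMap_mul hP a.2 b.2
  map_zero' := brauerMap_zero P
  map_add' _ _ := brauerMap_add P _ _

/-- The dichotomy for the Brauer image of a primitive idempotent of `(kG)^Q` under a `Q`-stable
central idempotent of `k C_G(P)`. -/
theorem mul_brauerMap_eq (hP : IsPGroup p P) (hPQ : P ≤ Q) {i e : MonoidAlgebra k G}
    (hi : IsPrimitiveIdempotent (fixedAlgebra k Q) i)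
    (he : e ∈ centerOf (centralizerAlgebra k P)) (hee : e * e = e) (heQ : e ∈ fixedAlgebra k Q) :
    e * brauerMap P i = 0 ∨ e * brauerMap P i = brauerMap P i := by
  have h := hi.map_mul_eq
    ((brauerHom k hP).comp (Subalgebra.inclusion (fixedAlgebra_antitone hPQ)).toRingHom) heQ
  have h1 : ∀ x : fixedAlgebra k Q,
      ((brauerHom k hP).comp (Subalgebra.inclusion (fixedAlgebra_antitone hPQ)).toRingHom) x =
        brauerMap P x := fun _ => rfl
  simp only [h1, brauerMap_eq_self he.1] at h
  exact h hee ((Subalgebra.mem_centralizer_iff k).1 he.2 _ (brauerMap_mem P i)).symm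

end BrauerMap

theorem IsBlockIdempotent.brauerMap_mul_self {p : ℕ} [Fact p.Prime] {k G : Type*} [Field k]
    [CharP k p] [Group G] [Finite G] {b : MonoidAlgebra k G}
    (hb : IsBlockIdempotent (⊤ : Subalgebra k (MonoidAlgebra k G)) b) {P : Subgroup G}
    (hP : IsPGroup p P) : brauerMap P b * brauerMap P b = brauerMap P b := by
  have := fixedAlgebra_le_of_mem_centerOf hb.mem P
  rw [← brauerMap_mul hP this this, hb.idem]

theorem conj_eq_self_of_mem_centerOf {k G : Type*} [Field k] [Group G] {b : MonoidAlgebra k G}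
    (hb : b ∈ centerOf (⊤ : Subalgebra k (MonoidAlgebra k G))) (x : G) : conj k x b = b :=
  mem_centerOf_top.1 hb x (Subgroup.mem_top x)

/-! ### Containment, block membership and maximality of Brauer pairs -/

namespace BrauerPair

section Order

variable {p : ℕ} {k G : Type*} [Field k] [Group G]

theorem smul_P (x : G) (X : BrauerPair p k G) : (x • X).P = MulAut.conj x • X.P := rfl

theorem smul_e (x : G) (X : BrauerPair p k G) : (x • X).e = conj k x X.e := rfl

theorem gal_smul_P {K : Type*} [Field K] [Algebra K k] (γ : k ≃ₐ[K] k) (X : BrauerPair p k G) :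
    (γ • X).P = X.P := rfl

theorem gal_smul_e {K : Type*} [Field K] [Algebra K k] (γ : k ≃ₐ[K] k) (X : BrauerPair p k G) :
    (γ • X).e = γ • X.e := rfl

theorem prod_smul_def {K : Type*} [Field K] [Algebra K k] (x : G) (γ : k ≃ₐ[K] k)
    (X : BrauerPair p k G) : (x, γ) • X = x • γ • X := rfl

theorem mem_fixedAlgebra (X : BrauerPair p k G) : X.e ∈ fixedAlgebra k X.P :=
  centralizerAlgebra_le_fixedAlgebra X.P X.isBlock.mem.1

theorem conj_mem_fixedAlgebra (x : G) (P : Subgroup G) (a : MonoidAlgebra k G) :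
    conj k x a ∈ fixedAlgebra k (MulAut.conj x • P) ↔ a ∈ fixedAlgebra k P := by
  have h : ∀ y, conj k (x * y * x⁻¹) (conj k x a) = conj k x (conj k y a) := fun y => by
    rw [← conj_mul, ← conj_mul]
    congr 1
    group
  constructor
  · intro ha y hy
    apply (conj k x).injective
    rw [← h, ha]
    exact Subgroup.smul_mem_pointwise_smul y (MulAut.conj x) P hy
  · intro ha y hy
    obtain ⟨y, hy, rfl⟩ := hy
    exact (h y).trans (by rw [ha y hy])

theorem isAssociated_smul (x : G) {X : BrauerPair p k G} {i : MonoidAlgebra k G}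
    (h : X.IsAssociated i) : (x • X).IsAssociated (conj k x i) := by
  refine ⟨?_, ?_⟩
  · rw [smul_P, smul_e, ← conj_brauerMap, ← map_mul, h.1]
  · rw [smul_P, ← conj_brauerMap]
    simpa using h.2

theorem smul_le_smul (x : G) {X Y : BrauerPair p k G} (h : X ≤ Y) : x • X ≤ x • Y := by
  refine ⟨Subgroup.pointwise_smul_le_pointwise_smul_iff.2 h.1, fun i hi hYi => ?_⟩
  have hx : conj k x (conj k x⁻¹ i) = i := by rw [← conj_mul, mul_inv_cancel, conj_one]
  have hYi' := isAssociated_smul x⁻¹ hYi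
  rw [inv_smul_smul] at hYi'
  rw [← hx]
  refine isAssociated_smul x (h.2 _ ?_ hYi')
  refine hi.map (conj k x⁻¹).toRingEquiv fun a => ?_
  have := conj_mem_fixedAlgebra x⁻¹ (MulAut.conj x • Y.P) a
  rwa [← mul_smul, ← map_mul, inv_mul_cancel, map_one, one_smul] at this

theorem belongs_smul (x : G) {b : MonoidAlgebra k G} {X : BrauerPair p k G} (h : Belongs b X) :
    Belongs (conj k x b) (x • X) := by
  rw [Belongs, smul_P, smul_e, ← conj_brauerMap, ← map_mul, h]

theorem maximal_smul (x : G) {b : MonoidAlgebra k G}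
    (hb : b ∈ centerOf (⊤ : Subalgebra k (MonoidAlgebra k G))) {X : BrauerPair p k G}
    (h : Maximal (Belongs b) X) : Maximal (Belongs b) (x • X) := by
  have hb' := conj_eq_self_of_mem_centerOf hb
  refine ⟨by simpa [hb'] using belongs_smul x h.1, fun Y hY hXY => ?_⟩
  have h1 := belongs_smul x⁻¹ hY
  rw [hb'] at h1
  have h2 := smul_le_smul x⁻¹ hXY
  rw [inv_smul_smul] at h2
  simpa using smul_le_smul x (h.2 h1 h2)

variable {K : Type*} [Field K] [Algebra K k]

theorem gal_smul_mul (γ : k ≃ₐ[K] k) (a b : MonoidAlgebra k G) : γ • (a * b) = γ • a * γ • b := by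
  simp only [← galRingEquiv_apply, map_mul]

theorem isAssociated_gal_smul (γ : k ≃ₐ[K] k) {X : BrauerPair p k G} {i : MonoidAlgebra k G}
    (h : X.IsAssociated i) : (γ • X).IsAssociated (γ • i) := by
  refine ⟨?_, ?_⟩
  · rw [gal_smul_P, gal_smul_e, ← smul_brauerMap, ← gal_smul_mul, h.1]
  · rw [gal_smul_P, ← smul_brauerMap]
    simpa [smul_eq_zero_iff_eq] using h.2

theorem gal_smul_mem_fixedAlgebra (γ : k ≃ₐ[K] k) (P : Subgroup G) (a : MonoidAlgebra k G) :
    γ • a ∈ fixedAlgebra k P ↔ a ∈ fixedAlgebra k P := by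
  have h : ∀ x, conj k x (γ • a) = γ • conj k x a := fun x => by
    ext g
    simp [coeff_conj]
  exact forall₂_congr fun x _ => by rw [h, smul_left_cancel_iff]

theorem gal_smul_le_smul (γ : k ≃ₐ[K] k) {X Y : BrauerPair p k G} (h : X ≤ Y) :
    γ • X ≤ γ • Y := by
  refine ⟨h.1, fun i hi hYi => ?_⟩
  have hYi' := isAssociated_gal_smul γ⁻¹ hYi
  rw [inv_smul_smul] at hYi'
  rw [← smul_inv_smul γ i]
  refine isAssociated_gal_smul γ (h.2 _ ?_ hYi')
  rw [← galRingEquiv_apply]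
  refine hi.map _ fun a => ?_
  rw [galRingEquiv_apply]
  exact gal_smul_mem_fixedAlgebra γ⁻¹ Y.P a

theorem belongs_gal_smul (γ : k ≃ₐ[K] k) {b : MonoidAlgebra k G} {X : BrauerPair p k G}
    (h : Belongs b X) : Belongs (γ • b) (γ • X) := by
  rw [Belongs, gal_smul_P, gal_smul_e, ← smul_brauerMap, ← gal_smul_mul, h]

theorem maximal_gal_smul {γ : k ≃ₐ[K] k} {b : MonoidAlgebra k G} (hγ : γ • b = b)
    {X : BrauerPair p k G} (h : Maximal (Belongs b) X) : Maximal (Belongs b) (γ • X) := by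
  have hγ' : γ⁻¹ • b = b := by rw [inv_smul_eq_iff, hγ]
  refine ⟨by simpa [hγ] using belongs_gal_smul γ h.1, fun Y hY hXY => ?_⟩
  have h1 := belongs_gal_smul γ⁻¹ hY
  rw [hγ'] at h1
  have h2 := gal_smul_le_smul γ⁻¹ hXY
  rw [inv_smul_smul] at h2
  simpa using gal_smul_le_smul γ (h.2 h1 h2)

end Order

variable {p : ℕ} [Fact p.Prime] {k G : Type*} [Field k] [CharP k p] [Group G] [Finite G]

/-- The idempotent `e` lies in `(kG)^P` and is its own Brauer image, so some primitive summand of it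
survives the Brauer homomorphism. Without such a witness the relation `≤` would carry no information
about the idempotents. -/
theorem exists_isAssociated (X : BrauerPair p k G) :
    ∃ i, IsPrimitiveIdempotent (fixedAlgebra k X.P) i ∧ X.IsAssociated i := by
  obtain ⟨i, hi, hei, hi0⟩ := exists_isPrimitiveIdempotent_map_ne_zero (brauerHom k X.isPGroup)
    (c := ⟨X.e, X.mem_fixedAlgebra⟩) (Subtype.ext X.isBlock.idem) (by
      change brauerMap X.P X.e ≠ 0
      rw [brauerMap_eq_self X.isBlock.mem.1]
      exact X.isBlock.ne_zero)
  refine ⟨i, hi, ?_, hi0⟩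
  have := congrArg (brauerHom k X.isPGroup) hei
  rw [map_mul] at this
  change brauerMap X.P X.e * brauerMap X.P i = brauerMap X.P i at this
  rwa [brauerMap_eq_self X.isBlock.mem.1] at this

/-- A Brauer pair contains at most one Brauer pair with a given first component. -/
theorem eq_of_le_of_le {R R' Q : BrauerPair p k G} (h : R ≤ Q) (h' : R' ≤ Q) (hP : R.P = R'.P) :
    R = R' := by
  -- A single `i` is associated to both smaller pairs, so its nonzero Brauer image would be fixed by
  -- two orthogonal idempotents.
  obtain ⟨i, hi, hQi⟩ := Q.exists_isAssociated
  have h1 := h.2 i hi hQi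
  have h2 := h'.2 i hi hQi
  refine BrauerPair.ext hP ?_
  by_contra hne
  have h3 := R.isBlock.mul_eq_zero (hP ▸ R'.isBlock) hne
  apply h1.2
  rw [← h1.1]
  have h4 := h2.1
  rw [← hP] at h4
  rw [← h4, ← mul_assoc, h3, zero_mul]

/-- A primitive idempotent `i` associated to the larger pair carries the membership down. Its Brauer
image there lies under that of `b`, so `b i = 0` is excluded and `b i = i`. Then the Brauer image of
`b` at the smaller group cannot annihilate the smaller block, since both act as the identity on the
nonzero image of `i`. -/
theorem belongs_of_le {b : MonoidAlgebra k G}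
    (hb : IsBlockIdempotent (⊤ : Subalgebra k (MonoidAlgebra k G)) b) {R Q : BrauerPair p k G}
    (h : R ≤ Q) (hQ : Belongs b Q) : Belongs b R := by
  obtain ⟨i, hi, hQi⟩ := Q.exists_isAssociated
  have hRi := h.2 i hi hQi
  have hbQ := fixedAlgebra_le_of_mem_centerOf hb.mem Q.P
  have hiR := fixedAlgebra_antitone h.1 hi.mem
  have hbR := fixedAlgebra_le_of_mem_centerOf hb.mem R.P
  have hbi : b * i = i := by
    rcases hi.map_mul_eq (fixedAlgebra k Q.P).val.toRingHom hbQ hb.idem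
      ((Subalgebra.mem_centralizer_iff k).1 hb.mem.2 i Algebra.mem_top).symm with h0 | h0
    · exfalso
      apply hQi.2
      change b * i = 0 at h0
      rw [← hQi.1, ← hQ, mul_assoc, hQi.1, ← brauerMap_mul Q.isPGroup hbQ hi.mem, h0,
        brauerMap_zero]
    · exact h0
  rcases R.isBlock.mul_eq (brauerMap_mem_centerOf_of_top hb.mem R.P)
    (hb.brauerMap_mul_self R.isPGroup) with h0 | h0
  · exfalso
    apply hRi.2
    have hcomm := centerOf_comm (brauerMap_mem_centerOf_of_top hb.mem R.P) R.isBlock.mem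
    rw [← hbi, brauerMap_mul R.isPGroup hbR hiR, ← hRi.1, ← mul_assoc, h0, zero_mul]
  · exact h0

/-- A Brauer pair belongs to only one block. -/
theorem eq_of_belongs {b c : MonoidAlgebra k G}
    (hb : IsBlockIdempotent (⊤ : Subalgebra k (MonoidAlgebra k G)) b)
    (hc : IsBlockIdempotent (⊤ : Subalgebra k (MonoidAlgebra k G)) c) {X : BrauerPair p k G}
    (hbX : Belongs b X) (hcX : Belongs c X) : b = c := by
  by_contra hne
  have h := brauerMap_mul X.isPGroup (fixedAlgebra_le_of_mem_centerOf hb.mem X.P)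
    (fixedAlgebra_le_of_mem_centerOf hc.mem X.P)
  rw [hb.mul_eq_zero hc hne, brauerMap_zero] at h
  apply X.isBlock.ne_zero
  rw [← hbX, ← hcX, ← mul_assoc, ← h, zero_mul]

/-- For a maximal pair `(P, e)`, the idempotent `e` vanishes under the Brauer maps of all larger
`p`-groups that normalize `P` and fix `e`. -/
theorem brauerMap_eq_zero_of_maximal {b : MonoidAlgebra k G}
    (hb : IsBlockIdempotent (⊤ : Subalgebra k (MonoidAlgebra k G)) b) {X : BrauerPair p k G}
    (hX : Maximal (Belongs b) X) {Q : Subgroup G} (hQ : IsPGroup p Q) (hPQ : X.P < Q)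
    (hN : Q ≤ Subgroup.normalizer X.P) (he : X.e ∈ fixedAlgebra k Q) : brauerMap Q X.e = 0 := by
  by_contra h0
  have hcen := brauerMap_mem_centerOf hPQ.le X.isBlock.mem
  have hidem : brauerMap Q X.e * brauerMap Q X.e = brauerMap Q X.e := by
    rw [← brauerMap_mul hQ he he, X.isBlock.idem]
  -- If `Br_Q(e)` were nonzero, it would be a central idempotent of `kC_G(Q)` with a block `f` under
  -- it. The pair `(Q, f)` would then belong to `b` and lie strictly above `(P, e)`.
  obtain ⟨⟨f, hfc⟩, hf, hef, -⟩ := exists_isPrimitiveIdempotent_map_ne_zero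
    (S := centerOf (centralizerAlgebra k Q)) (centerOf (centralizerAlgebra k Q)).val.toRingHom
    (c := ⟨_, hcen⟩) (Subtype.ext hidem) h0
  replace hef : brauerMap Q X.e * f = f := congrArg Subtype.val hef
  have hbQ := fixedAlgebra_le_of_mem_centerOf hb.mem Q
  let Y : BrauerPair p k G := ⟨Q, f, hQ, hf⟩
  have hY : Belongs b Y := by
    change brauerMap Q b * f = f
    have h1 := congrArg (brauerMap Q) hX.1
    rw [brauerMap_mul hQ (brauerMap_mem_fixedAlgebra hN hbQ) he, brauerMap_brauerMap hPQ.le] at h1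
    rw [← hef, ← mul_assoc, h1]
  have hXY : X ≤ Y := by
    refine ⟨hPQ.le, fun i hi hYi => ?_⟩
    have hY1 : f * brauerMap Q i = brauerMap Q i := hYi.1
    have hY2 : brauerMap Q i ≠ 0 := hYi.2
    refine ⟨?_, fun h => hY2 ?_⟩
    -- By the dichotomy it suffices to exclude `e Br_P(i) = 0`. Applying `Br_Q` to it would give
    -- `Br_Q(e) Br_Q(i) = 0`, although `f ≤ Br_Q(e)` fixes `Br_Q(i) ≠ 0`.
    · rcases mul_brauerMap_eq X.isPGroup hPQ.le hi X.isBlock.mem X.isBlock.idem he with h | h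
      · exfalso
        apply hY2
        have h1 := congrArg (brauerMap Q) h
        rw [brauerMap_mul hQ he (brauerMap_mem_fixedAlgebra hN hi.mem),
          brauerMap_brauerMap hPQ.le, brauerMap_zero] at h1
        rw [← hY1, ← hef, mul_assoc, hY1, h1]
      · exact h
    · rw [← brauerMap_brauerMap hPQ.le, h, brauerMap_zero]
  exact hPQ.not_ge (hX.2 hY hXY).1

end BrauerPair

/-! ### Sylow subgroups, normalizers and conjugation -/

/-- Sylow's theorem in a subgroup `H`: every `p`-subgroup of `H` is conjugate into a maximal one. -/
theorem exists_conj_smul_le_of_maximal {p : ℕ} [Fact p.Prime] {G : Type*} [Group G] [Finite G]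
    {H P R : Subgroup G} (hP : IsPGroup p P) (hPH : P ≤ H)
    (hmax : ∀ S : Subgroup G, IsPGroup p S → S ≤ H → P ≤ S → S = P)
    (hR : IsPGroup p R) (hRH : R ≤ H) : ∃ y ∈ H, MulAut.conj y • R ≤ P := by
  let P' : Sylow p H := ⟨P.subgroupOf H, hP.comap_of_injective H.subtype H.subtype_injective, by
    intro Q hQ hPQ
    have h1 := hmax (Q.map H.subtype) (hQ.map _) (Subgroup.map_subtype_le Q) (by
      rw [← Subgroup.map_subgroupOf_eq_of_le hPH]
      exact Subgroup.map_mono hPQ)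
    rw [← h1]
    exact (Subgroup.comap_map_eq_self_of_injective H.subtype_injective Q).symm⟩
  obtain ⟨T, hT⟩ := (hR.comap_of_injective H.subtype H.subtype_injective).exists_le_sylow
  obtain ⟨y, hy⟩ := exists_smul_eq H T P'
  refine ⟨y, y.2, ?_⟩
  rintro _ ⟨r, hr, rfl⟩
  have h1 : y * ⟨r, hRH hr⟩ * y⁻¹ ∈ P' := by
    rw [← hy]
    exact ⟨⟨r, hRH hr⟩, hT (show (⟨r, hRH hr⟩ : H) ∈ R.subgroupOf H from hr), rfl⟩
  exact h1

/-- Normalizers grow: a proper subgroup of a finite `p`-group is properly contained in a subgroup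
that normalizes it. -/
theorem exists_lt_le_normalizer {p : ℕ} [Fact p.Prime] {G : Type*} [Group G] [Finite G]
    {P S : Subgroup G} (hS : IsPGroup p S) (hPS : P < S) :
    ∃ Q, P < Q ∧ Q ≤ S ∧ Q ≤ Subgroup.normalizer P := by
  have := hS.isNilpotent
  have hlt : P.subgroupOf S < ⊤ := by
    rw [lt_top_iff_ne_top, Ne, Subgroup.subgroupOf_eq_top]
    exact hPS.not_ge
  have h1 := Group.normalizerCondition_of_isNilpotent (G := S) _ hlt
  refine ⟨(Subgroup.normalizer (P.subgroupOf S : Set S)).map S.subtype, ?_,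
    Subgroup.map_subtype_le _, ?_⟩
  · have h2 := (Subgroup.map_lt_map_iff_of_injective S.subtype_injective).2 h1
    rwa [Subgroup.map_subgroupOf_eq_of_le hPS.le] at h2
  · rintro _ ⟨x, hx, rfl⟩
    rw [SetLike.mem_coe, Subgroup.mem_normalizer_iff] at hx
    refine Subgroup.mem_normalizer_iff.2 fun g => ?_
    -- The normalizer was taken inside `S`. For `g` outside `S` neither `g` nor its conjugate by `x
    -- ∈ S` can lie in `P ≤ S`.
    by_cases hg : g ∈ S
    · exact hx ⟨g, hg⟩
    · refine ⟨fun h => absurd (hPS.le h) hg, fun h => absurd ?_ hg⟩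
      have := mul_mem (mul_mem (inv_mem x.2) (hPS.le h)) x.2
      simpa [mul_assoc] using this

theorem le_centralizer_singleton_conj {G : Type*} [Group G] {R : Subgroup G} {g x : G}
    (hg : g ∈ Subgroup.centralizer (R : Set G)) :
    MulAut.conj x • R ≤ Subgroup.centralizer {x * g * x⁻¹} := by
  rintro _ ⟨r, hr, rfl⟩
  rw [Subgroup.mem_centralizer_singleton_iff]
  change x * r * x⁻¹ * (x * g * x⁻¹) = x * g * x⁻¹ * (x * r * x⁻¹)
  have := hg r hr
  calc x * r * x⁻¹ * (x * g * x⁻¹) = x * (r * g) * x⁻¹ := by group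
    _ = x * (g * r) * x⁻¹ := by rw [this]
    _ = _ := by group

theorem isPGroup_conj_smul {p : ℕ} {G : Type*} [Group G] {R : Subgroup G}
    (hR : IsPGroup p R) (x : G) :
    IsPGroup p (MulAut.conj x • R : Subgroup G) :=
  hR.map (MulDistribMulAction.toMonoidHom G (MulAut.conj x))

theorem conj_smul_eq_of_le {G : Type*} [Group G] [Finite G] {P : Subgroup G} {x : G}
    (h : MulAut.conj x • P ≤ P) :
    MulAut.conj x • P = P :=
  SetLike.coe_injective (Set.eq_of_subset_of_ncard_le h (by
    rw [Subgroup.coe_pointwise_smul, Set.ncard_smul_set]))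

/-! ### Conjugacy of maximal Brauer pairs through orbit sums -/

namespace BrauerPair

theorem coeff_smul_e_of_commute {p : ℕ} {k G : Type*} [Field k] [Group G] {x g : G}
    (h : x * g = g * x) (Y : BrauerPair p k G) :
    (x • Y).e.coeff g = Y.e.coeff g := by
  rw [smul_e, coeff_conj, mul_assoc, ← h, inv_mul_cancel_left]

variable {p : ℕ} {k G : Type*} [Field k] [Group G] [Finite G]

/-- The set of `G`-conjugates of `X` with the same first component. -/
noncomputable def conjugatesSameGroup (X : BrauerPair p k G) : Finset (BrauerPair p k G) :=
  ((Set.finite_range fun x : G => x • X).inter_of_left {Y | Y.P = X.P}).toFinset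

theorem mem_conjugatesSameGroup {X Y : BrauerPair p k G} :
    Y ∈ X.conjugatesSameGroup ↔ Y ∈ orbit G X ∧ Y.P = X.P := by
  rw [conjugatesSameGroup, Set.Finite.mem_toFinset]
  rfl

theorem self_mem_conjugatesSameGroup (X : BrauerPair p k G) : X ∈ X.conjugatesSameGroup :=
  mem_conjugatesSameGroup.2 ⟨mem_orbit_self X, rfl⟩

theorem smul_mem_conjugatesSameGroup {X Y : BrauerPair p k G} (hY : Y ∈ X.conjugatesSameGroup)
    {x : G} (hx : MulAut.conj x • X.P = X.P) : x • Y ∈ X.conjugatesSameGroup := by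
  rw [mem_conjugatesSameGroup] at hY ⊢
  exact ⟨mem_orbit_of_mem_orbit x hY.1, by rw [smul_P, hY.2, hx]⟩

/-- The sum of the `N_G(P)`-conjugates of `e`. -/
noncomputable def normalizerOrbitSum (X : BrauerPair p k G) : MonoidAlgebra k G :=
  ∑ Y ∈ X.conjugatesSameGroup, Y.e

theorem normalizerOrbitSum_mem (X : BrauerPair p k G) :
    X.normalizerOrbitSum ∈ centralizerAlgebra k X.P :=
  sum_mem fun Y hY => (mem_conjugatesSameGroup.1 hY).2 ▸ Y.isBlock.mem.1

theorem conj_normalizerOrbitSum (X : BrauerPair p k G) {x : G}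
    (hx : MulAut.conj x • X.P = X.P) :
    conj k x X.normalizerOrbitSum = X.normalizerOrbitSum := by
  have hx' : MulAut.conj x⁻¹ • X.P = X.P := by rw [map_inv, inv_smul_eq_iff, hx]
  rw [normalizerOrbitSum, map_sum]
  refine Finset.sum_bij' (fun Y _ => x • Y) (fun Y _ => x⁻¹ • Y)
    (fun Y hY => smul_mem_conjugatesSameGroup hY hx)
    (fun Y hY => smul_mem_conjugatesSameGroup hY hx') ?_ ?_ ?_ <;> simp [smul_e]

theorem coeff_normalizerOrbitSum (X : BrauerPair p k G) (g : G) :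
    X.normalizerOrbitSum.coeff g = ∑ Y ∈ X.conjugatesSameGroup, Y.e.coeff g := by
  simp [normalizerOrbitSum]

theorem mul_normalizerOrbitSum (X : BrauerPair p k G) : X.e * X.normalizerOrbitSum = X.e := by
  rw [normalizerOrbitSum, Finset.mul_sum,
    Finset.sum_eq_single_of_mem X X.self_mem_conjugatesSameGroup, X.isBlock.idem]
  intro Y hY hne
  have hP := (mem_conjugatesSameGroup.1 hY).2
  exact X.isBlock.mul_eq_zero (hP ▸ Y.isBlock) fun h => hne (BrauerPair.ext hP h.symm)

variable [Fact p.Prime] [CharP k p] {b : MonoidAlgebra k G}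

/-- For a maximal pair `(P, e)`, the group `P` is a Sylow subgroup of the centralizer of every
element in the support of the sum of the `N_G(P)`-conjugates of `e`. -/
theorem eq_of_coeff_normalizerOrbitSum_ne_zero
    (hb : IsBlockIdempotent (⊤ : Subalgebra k (MonoidAlgebra k G)) b) {X : BrauerPair p k G}
    (hX : Maximal (Belongs b) X) {g : G} (hg : X.normalizerOrbitSum.coeff g ≠ 0) {S : Subgroup G}
    (hS : IsPGroup p S) (hSg : S ≤ Subgroup.centralizer {g}) (hPS : X.P ≤ S) : S = X.P := by
  classical
  by_contra hne
  obtain ⟨Q, hPQ, hQS, hQN⟩ := exists_lt_le_normalizer hS (lt_of_le_of_ne hPS (Ne.symm hne))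
  have hQ : IsPGroup p Q := hS.to_le hQS
  have hcomm : ∀ x ∈ Q, x * g = g * x := fun x hx =>
    (Subgroup.mem_centralizer_singleton_iff.1 (hSg (hQS hx)))
  have hgQ : g ∈ Subgroup.centralizer (Q : Set G) := hcomm
  apply hg
  -- `Q` permutes the conjugates of `e` and centralizes `g`, so only `Q`-fixed conjugates contribute
  -- to the coefficient at `g`. These are maximal too and have zero image under `Br_Q`, which keeps
  -- the coefficient at `g`.
  rw [coeff_normalizerOrbitSum, sum_eq_sum_fixedPoints hQ]
  · refine Finset.sum_eq_zero fun Y hY => ?_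
    rw [Finset.mem_filter, mem_conjugatesSameGroup] at hY
    obtain ⟨⟨⟨x, rfl⟩, hYP⟩, hfix⟩ := hY
    have h0 := brauerMap_eq_zero_of_maximal hb (maximal_smul x hb.mem hX) hQ (by rwa [hYP])
      (by rwa [hYP]) fun y hy => congrArg BrauerPair.e (hfix ⟨y, hy⟩)
    rw [← coeff_brauerMap_of_mem _ hgQ]
    exact (congrArg (fun c => c.coeff g) h0).trans rfl
  · exact fun x Y hY =>
      smul_mem_conjugatesSameGroup hY (conj_smul_eq_self_of_le_normalizer hQN x.2)
  · exact fun x Y _ => coeff_smul_e_of_commute (hcomm x x.2) Y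

/-- Both `P` and `x R x⁻¹` centralize `x g x⁻¹`, and `P` is Sylow in that centralizer; the element
`y` comes from Sylow's theorem there. -/
theorem exists_conj_smul_le_of_coeff_ne_zero
    (hb : IsBlockIdempotent (⊤ : Subalgebra k (MonoidAlgebra k G)) b) {X : BrauerPair p k G}
    (hX : Maximal (Belongs b) X) {g x : G} (hg : X.normalizerOrbitSum.coeff (x * g * x⁻¹) ≠ 0)
    {R : Subgroup G} (hR : IsPGroup p R) (hgR : g ∈ Subgroup.centralizer (R : Set G)) :
    ∃ y, y * (x * g * x⁻¹) = (x * g * x⁻¹) * y ∧ MulAut.conj (y * x) • R ≤ X.P := by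
  have hgP := X.normalizerOrbitSum_mem _ hg
  obtain ⟨y, hy, hyR⟩ := exists_conj_smul_le_of_maximal X.isPGroup
    (fun r hr => Subgroup.mem_centralizer_singleton_iff.2 (hgP r hr))
    (fun S hS hSg hPS => eq_of_coeff_normalizerOrbitSum_ne_zero hb hX hg hS hSg hPS)
    (isPGroup_conj_smul hR x) (le_centralizer_singleton_conj hgR)
  refine ⟨y, Subgroup.mem_centralizer_singleton_iff.1 hy, ?_⟩
  rwa [map_mul, mul_smul]

/-- Burnside's fusion argument. Taking `R = P` above, `y x` normalizes `P`, and since `y` commutes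
with `x g x⁻¹`, it still carries `g` to `x g x⁻¹`. The orbit sum is invariant under `N_G(P)`. -/
theorem coeff_normalizerOrbitSum_conj
    (hb : IsBlockIdempotent (⊤ : Subalgebra k (MonoidAlgebra k G)) b) {X : BrauerPair p k G}
    (hX : Maximal (Belongs b) X) {g x : G} (hg : g ∈ Subgroup.centralizer (X.P : Set G))
    (hgx : X.normalizerOrbitSum.coeff (x * g * x⁻¹) ≠ 0) :
    X.normalizerOrbitSum.coeff g = X.normalizerOrbitSum.coeff (x * g * x⁻¹) := by
  obtain ⟨y, hy, hle⟩ := exists_conj_smul_le_of_coeff_ne_zero hb hX hgx X.isPGroup hg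
  have h1 := X.conj_normalizerOrbitSum (conj_smul_eq_of_le hle)
  have h2 := congrArg (fun c => c.coeff (x * g * x⁻¹)) h1
  simp only [coeff_conj] at h2
  rw [← h2]
  congr 1
  have h3 : y⁻¹ * (x * g * x⁻¹) * y = x * g * x⁻¹ := by
    rw [mul_assoc, ← hy, inv_mul_cancel_left]
  calc g = x⁻¹ * (x * g * x⁻¹) * x := by group
    _ = x⁻¹ * (y⁻¹ * (x * g * x⁻¹) * y) * x := by rw [h3]
    _ = _ := by group

/-- The sum of the `N_G(P)`-conjugates of `e` is the Brauer image of a central element `z`, all of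
whose nonzero Brauer images belong to subgroups of conjugates of `P`. -/
theorem exists_brauerMap_eq_normalizerOrbitSum
    (hb : IsBlockIdempotent (⊤ : Subalgebra k (MonoidAlgebra k G)) b) {X : BrauerPair p k G}
    (hX : Maximal (Belongs b) X) :
    ∃ z ∈ centerOf (⊤ : Subalgebra k (MonoidAlgebra k G)),
      brauerMap X.P z = X.normalizerOrbitSum ∧
      ∀ R : Subgroup G, IsPGroup p R → brauerMap R z ≠ 0 → ∃ x : G, MulAut.conj x • R ≤ X.P := by
  classical
  -- By fusion the orbit sum takes one value on the part of a class inside `C_G(P)`, provided it is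
  -- nonzero somewhere on the class. Spreading that value over the whole class, and zero over the
  -- other classes, gives the central element `z`.
  have hr : ∀ c : ConjClasses G, ∃ r : k,
      (∀ g ∈ Subgroup.centralizer (X.P : Set G), ConjClasses.mk g = c →
        X.normalizerOrbitSum.coeff g = r) ∧
      (r ≠ 0 → ∃ g, ConjClasses.mk g = c ∧ X.normalizerOrbitSum.coeff g ≠ 0) := by
    intro c
    by_cases h : ∃ g, ConjClasses.mk g = c ∧ X.normalizerOrbitSum.coeff g ≠ 0
    · obtain ⟨g, rfl, hg⟩ := h
      refine ⟨X.normalizerOrbitSum.coeff g, fun g' hg' hc => ?_, fun _ => ⟨g, rfl, hg⟩⟩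
      obtain ⟨x, rfl⟩ := isConj_iff.1 (ConjClasses.mk_eq_mk_iff_isConj.1 hc)
      exact coeff_normalizerOrbitSum_conj hb hX hg' hg
    · refine ⟨0, fun g _ hc => ?_, fun h0 => absurd rfl h0⟩
      by_contra hg
      exact h ⟨g, hc, hg⟩
  choose r hr hr0 using hr
  let z : MonoidAlgebra k G :=
    MonoidAlgebra.ofCoeff (Finsupp.equivFunOnFinite.symm fun g => r (ConjClasses.mk g))
  have hz : ∀ g, z.coeff g = r (ConjClasses.mk g) := fun g => rfl
  refine ⟨z, ?_, ?_, ?_⟩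
  · refine mem_centerOf_top.2 fun x _ => ?_
    ext g
    rw [coeff_conj, hz, hz]
    congr 1
    exact ConjClasses.mk_eq_mk_iff_isConj.2 (isConj_iff.2 ⟨x, by group⟩)
  · ext g
    by_cases hg : g ∈ Subgroup.centralizer (X.P : Set G)
    · rw [coeff_brauerMap_of_mem _ hg, hz, hr _ g hg rfl]
    · rw [coeff_brauerMap_of_notMem _ hg]
      by_contra h
      exact hg (X.normalizerOrbitSum_mem g (Ne.symm h))
  · intro R hR hzR
    obtain ⟨g, hg⟩ : ∃ g, (brauerMap R z).coeff g ≠ 0 := by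
      by_contra! h
      exact hzR (by ext g; exact h g)
    have hgR := brauerMap_mem R z g hg
    rw [coeff_brauerMap_of_mem _ hgR, hz] at hg
    obtain ⟨g', hc, hg'⟩ := hr0 _ hg
    obtain ⟨x, rfl⟩ := isConj_iff.1 (ConjClasses.mk_eq_mk_iff_isConj.1 hc.symm)
    obtain ⟨y, -, h⟩ := exists_conj_smul_le_of_coeff_ne_zero hb hX hg' hR hgR
    exact ⟨_, h⟩

/-- The block `b` is recovered from the central element lifting the orbit sum. -/
theorem exists_mul_eq_block
    (hb : IsBlockIdempotent (⊤ : Subalgebra k (MonoidAlgebra k G)) b) {X : BrauerPair p k G}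
    (hXb : Belongs b X) {z : MonoidAlgebra k G}
    (hz : z ∈ centerOf (⊤ : Subalgebra k (MonoidAlgebra k G)))
    (hzX : brauerMap X.P z = X.normalizerOrbitSum) :
    ∃ w ∈ centerOf (⊤ : Subalgebra k (MonoidAlgebra k G)), z * w = b := by
  have hzb := centerOf_comm hz hb.mem
  -- `Z(kG) b` is local, so `z b` is nilpotent or invertible there. Nilpotency is impossible because
  -- `e Br_P((z b) ^ m) = e` for every `m`.
  rcases hb.isNilpotent_or_exists_inverse (mul_mem hz hb.mem)
    (by rw [hzb, ← mul_assoc, hb.idem]) (by rw [mul_assoc, hb.idem]) with ⟨n, hn⟩ | ⟨w, hw, h⟩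
  · exfalso
    have hmem := fixedAlgebra_le_of_mem_centerOf (mul_mem hz hb.mem) X.P
    have h1 : X.e * brauerMap X.P (z * b) = X.e := by
      rw [brauerMap_mul X.isPGroup (fixedAlgebra_le_of_mem_centerOf hz X.P)
        (fixedAlgebra_le_of_mem_centerOf hb.mem X.P), hzX, ← mul_assoc, mul_normalizerOrbitSum,
        centerOf_comm X.isBlock.mem (brauerMap_mem_centerOf_of_top hb.mem X.P), hXb]
    have h2 : ∀ m : ℕ, X.e * brauerMap X.P ((z * b) ^ m) = X.e := by
      intro m
      induction m with
      | zero => rw [pow_zero, brauerMap_one, mul_one]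
      | succ m ih => rw [pow_succ, brauerMap_mul X.isPGroup (pow_mem hmem m) hmem, ← mul_assoc,
          ih, h1]
    have h3 := h2 n
    rw [hn, brauerMap_zero, mul_zero] at h3
    exact X.isBlock.ne_zero h3.symm
  · exact ⟨b * w, mul_mem hb.mem hw, by rw [← mul_assoc, h]⟩

/-- All maximal Brauer pairs of a block are conjugate. -/
theorem mem_orbit_of_maximal
    (hb : IsBlockIdempotent (⊤ : Subalgebra k (MonoidAlgebra k G)) b) {X Y : BrauerPair p k G}
    (hX : Maximal (Belongs b) X) (hY : Maximal (Belongs b) Y) : Y ∈ orbit G X := by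
  have key : ∀ {X Y : BrauerPair p k G}, Maximal (Belongs b) X → Belongs b Y →
      (∃ x : G, MulAut.conj x • Y.P ≤ X.P) ∧ (Y.P = X.P → Y ∈ orbit G X) := by
    intro X Y hX hY
    obtain ⟨z, hz, hzX, hzR⟩ := exists_brauerMap_eq_normalizerOrbitSum hb hX
    obtain ⟨w, hw, h⟩ := exists_mul_eq_block hb hX.1 hz hzX
    have h1 : brauerMap Y.P z * brauerMap Y.P w * Y.e = Y.e := by
      rw [← brauerMap_mul Y.isPGroup (fixedAlgebra_le_of_mem_centerOf hz Y.P)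
        (fixedAlgebra_le_of_mem_centerOf hw Y.P), h, hY]
    refine ⟨hzR Y.P Y.isPGroup fun h0 => ?_, fun hP => ?_⟩
    · rw [h0, zero_mul, zero_mul] at h1
      exact Y.isBlock.ne_zero h1.symm
    -- If `Y` is not conjugate to `X`, its block is orthogonal to every summand of the orbit sum
    -- `Br_P(z)`, against `Br_P(z w) Y.e = Y.e`.
    · by_contra hne
      apply Y.isBlock.ne_zero
      rw [mul_assoc, centerOf_comm (brauerMap_mem_centerOf_of_top hw Y.P) Y.isBlock.mem,
        ← mul_assoc, hP, hzX, normalizerOrbitSum, Finset.sum_mul, Finset.sum_eq_zero,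
        zero_mul] at h1
      · exact h1.symm
      · intro Z hZ
        have hZ' := mem_conjugatesSameGroup.1 hZ
        refine Z.isBlock.mul_eq_zero ((hP.trans hZ'.2.symm) ▸ Y.isBlock) fun he => hne ?_
        rw [← BrauerPair.ext (hZ'.2.trans hP.symm) he]
        exact hZ'.1
  -- Each of the two groups has a conjugate inside the other. Their orders agree, so `x • Y` has
  -- first component exactly `X.P`.
  obtain ⟨x, hx⟩ := (key hX hY.1).1
  obtain ⟨y, hy⟩ := (key hY hX.1).1
  have hcard : ∀ (x : G) (P : Subgroup G),
      ((MulAut.conj x • P : Subgroup G) : Set G).ncard = (P : Set G).ncard := fun x P => by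
    rw [Subgroup.coe_pointwise_smul, Set.ncard_smul_set]
  have hle := Set.ncard_le_ncard (s := ((MulAut.conj y • X.P : Subgroup G) : Set G)) hy
  rw [hcard] at hle
  have hP : (x • Y).P = X.P := SetLike.coe_injective (Set.eq_of_subset_of_ncard_le hx (by
    rwa [smul_P, hcard]))
  have h := (key hX (maximal_smul x hb.mem hY).1).2 hP
  have h' := mem_orbit_of_mem_orbit x⁻¹ h
  rwa [inv_smul_smul] at h'

end BrauerPair

/-! ### Goursat's lemma, the Galois correspondence and cyclic quotients -/

/-- Both quotients are images of `I` with the same kernel. The four subgroups enter through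
equations, so that the result can be read off for stabilizers. -/
theorem goursat_quotients {G H : Type*} [Group G] [Group H] (I : Subgroup (G × H))
    {N M : Subgroup G} {A B : Subgroup H} (hN : I.goursatFst = N)
    (hM : I.map (MonoidHom.fst G H) = M) (hA : I.goursatSnd = A)
    (hB : I.map (MonoidHom.snd G H) = B) :
    N ≤ M ∧ A ≤ B ∧ ∃ (_ : (N.subgroupOf M).Normal) (_ : (A.subgroupOf B).Normal),
      Nonempty (M ⧸ N.subgroupOf M ≃* B ⧸ A.subgroupOf B) := by
  subst hN hM hA hB
  have h1 : (I.goursatFst.subgroupOf (I.map (MonoidHom.fst G H))).Normal := by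
    refine ⟨fun n hn g => ?_⟩
    obtain ⟨⟨x, y⟩, hxy, hg⟩ := g.2
    rw [Subgroup.mem_subgroupOf, Subgroup.mem_goursatFst] at hn ⊢
    have h := mul_mem (mul_mem hxy hn) (inv_mem hxy)
    simp only [Prod.mk_mul_mk, Prod.inv_mk, mul_one, mul_inv_cancel] at h
    simpa [← hg] using h
  have h2 : (I.goursatSnd.subgroupOf (I.map (MonoidHom.snd G H))).Normal := by
    refine ⟨fun n hn g => ?_⟩
    obtain ⟨⟨x, y⟩, hxy, hg⟩ := g.2
    rw [Subgroup.mem_subgroupOf, Subgroup.mem_goursatSnd] at hn ⊢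
    have h := mul_mem (mul_mem hxy hn) (inv_mem hxy)
    simp only [Prod.mk_mul_mk, Prod.inv_mk, mul_one, mul_inv_cancel] at h
    simpa [← hg] using h
  refine ⟨fun g hg => ⟨(g, 1), Subgroup.mem_goursatFst.1 hg, rfl⟩,
    fun g hg => ⟨(1, g), Subgroup.mem_goursatSnd.1 hg, rfl⟩, h1, h2, ?_⟩
  let f := (QuotientGroup.mk' (I.goursatFst.subgroupOf (I.map (MonoidHom.fst G H)))).comp
    ((MonoidHom.fst G H).subgroupMap I)
  let g := (QuotientGroup.mk' (I.goursatSnd.subgroupOf (I.map (MonoidHom.snd G H)))).comp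
    ((MonoidHom.snd G H).subgroupMap I)
  have hf : Function.Surjective f :=
    (QuotientGroup.mk'_surjective _).comp ((MonoidHom.fst G H).subgroupMap_surjective I)
  have hg : Function.Surjective g :=
    (QuotientGroup.mk'_surjective _).comp ((MonoidHom.snd G H).subgroupMap_surjective I)
  -- The product of `(x, 1)` and `(1, y)` is `(x, y) ∈ I`, so one factor lies in `I` exactly when
  -- the other does.
  have hker : f.ker = g.ker := by
    ext ⟨⟨x, y⟩, hxy⟩
    have hf' : ⟨(x, y), hxy⟩ ∈ f.ker ↔ (x, 1) ∈ I := by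
      rw [MonoidHom.mem_ker]
      change QuotientGroup.mk _ = _ ↔ _
      rw [QuotientGroup.eq_one_iff, Subgroup.mem_subgroupOf, Subgroup.mem_goursatFst]
      rfl
    have hg' : ⟨(x, y), hxy⟩ ∈ g.ker ↔ (1, y) ∈ I := by
      rw [MonoidHom.mem_ker]
      change QuotientGroup.mk _ = _ ↔ _
      rw [QuotientGroup.eq_one_iff, Subgroup.mem_subgroupOf, Subgroup.mem_goursatSnd]
      rfl
    rw [hf', hg']
    constructor
    · intro h
      simpa using mul_mem (inv_mem h) hxy
    · intro h
      simpa using mul_mem hxy (inv_mem h)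
  exact ⟨((QuotientGroup.quotientKerEquivOfSurjective f hf).symm.trans
    (QuotientGroup.quotientMulEquivOfEq hker)).trans
    (QuotientGroup.quotientKerEquivOfSurjective g hg)⟩

theorem isCyclic_quotient_of_ker_le {B C : Type*} [Group B] [Group C] [IsCyclic C] (ρ : B →* C)
    (N : Subgroup B) [N.Normal] (h : ρ.ker ≤ N) : IsCyclic (B ⧸ N) := by
  have h1 : IsCyclic (B ⧸ ρ.ker) :=
    isCyclic_of_surjective _ (QuotientGroup.quotientKerEquivRange ρ).symm.surjective
  refine isCyclic_of_surjective (QuotientGroup.map ρ.ker N (MonoidHom.id B) h) fun x => ?_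
  obtain ⟨y, rfl⟩ := QuotientGroup.mk_surjective x
  exact ⟨QuotientGroup.mk y, rfl⟩

/-- The Galois correspondence relative to `M`: the group of `L/M` is `B`, in which `A` is the normal
subgroup belonging to `N`. Restriction of automorphisms to `N` is onto with kernel `A`. -/
theorem isGalois_extendScalars {K L : Type*} [Field K] [Field L] [Algebra K L]
    [FiniteDimensional K L] [IsGalois K L] {M N : IntermediateField K L} (h : M ≤ N)
    {A B : Subgroup Gal(L/K)} (hB : M.fixingSubgroup = B) (hA : N.fixingSubgroup = A)
    [hn : (A.subgroupOf B).Normal] :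
    IsGalois M (IntermediateField.extendScalars h) ∧
      Nonempty (Gal(IntermediateField.extendScalars h/M) ≃* B ⧸ A.subgroupOf B) := by
  subst hB hA
  set E := IntermediateField.extendScalars h
  let φ := IntermediateField.fixingSubgroupEquiv M
  have hφ : ∀ (γ : M.fixingSubgroup) (x : L), φ γ x = γ.1 x := fun _ _ => rfl
  have hmem : ∀ γ : M.fixingSubgroup, φ γ ∈ E.fixingSubgroup ↔ γ.1 ∈ N.fixingSubgroup := by
    intro γ
    simp only [IntermediateField.mem_fixingSubgroup_iff, hφ]
    rfl
  have hEn : E.fixingSubgroup.Normal := by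
    have : E.fixingSubgroup =
        (N.fixingSubgroup.subgroupOf M.fixingSubgroup).map φ.toMonoidHom := by
      ext σ
      obtain ⟨γ, rfl⟩ := φ.surjective σ
      rw [hmem]
      constructor
      · exact fun hγ => ⟨γ, hγ, rfl⟩
      · rintro ⟨δ, hδ, hδγ⟩
        rw [← φ.injective hδγ]
        exact hδ
    rw [this]
    exact hn.map _ φ.surjective
  have hE : IsGalois M E := (InfiniteGalois.normal_iff_isGalois E).1 hEn
  refine ⟨hE, ?_⟩
  let f : M.fixingSubgroup →* Gal(E/M) := (AlgEquiv.restrictNormalHom E).comp φ.toMonoidHom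
  have hf : Function.Surjective f :=
    (AlgEquiv.restrictNormalHom_surjective L).comp φ.surjective
  have hker : N.fixingSubgroup.subgroupOf M.fixingSubgroup = f.ker := by
    ext γ
    rw [MonoidHom.mem_ker, Subgroup.mem_subgroupOf, ← hmem,
      ← IntermediateField.restrictNormalHom_ker, MonoidHom.mem_ker]
    rfl
  exact ⟨((QuotientGroup.quotientMulEquivOfEq hker).trans
    (QuotientGroup.quotientKerEquivOfSurjective f hf)).symm⟩

/-- A group of automorphisms acts through a cyclic group on any stable finite subfield. -/
theorem exists_cyclic_restriction.{u, v} {p : ℕ} [Fact p.Prime] {K : Type u} {L : Type v}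
    [Field K] [Field L] [CharP L p] [Algebra K L] (F : Subfield L) [Finite F]
    (hF : ∀ (γ : L ≃ₐ[K] L), ∀ x ∈ F, γ x ∈ F) :
    ∃ (C : Type v) (_ : Group C) (_ : IsCyclic C) (ρ : Gal(L/K) →* C),
      ∀ γ, ρ γ = 1 → ∀ x ∈ F, γ x = x := by
  let _ : Algebra (ZMod p) F := ZMod.algebra F p
  let ρ : Gal(L/K) →* Gal(F/ZMod p) :=
    { toFun := fun γ => AlgEquiv.ofRingEquiv (f :=
        { toFun := fun x => ⟨γ x, hF γ x x.2⟩
          invFun := fun x => ⟨γ⁻¹ x, hF γ⁻¹ x x.2⟩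
          left_inv := fun x => Subtype.ext (γ.symm_apply_apply x)
          right_inv := fun x => Subtype.ext (γ.apply_symm_apply x)
          map_mul' := fun x y => Subtype.ext (map_mul γ (x : L) y)
          map_add' := fun x y => Subtype.ext (map_add γ (x : L) y) })
        (fun r => by
          rw [← RingEquiv.coe_toRingHom, ← RingHom.comp_apply]
          exact RingHom.congr_fun (Subsingleton.elim _ _) r)
      map_one' := rfl
      map_mul' := fun _ _ => rfl }
  -- The automorphism group of a finite field over its prime field is cyclic, generated by
  -- Frobenius.
  refine ⟨Gal(F/ZMod p), inferInstance, inferInstance, ρ, fun γ hγ x hx => ?_⟩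
  exact congrArg Subtype.val (AlgEquiv.congr_fun hγ ⟨x, hx⟩)

/-! ### Finiteness of the field of coefficients of a block -/

section Frobenius

variable {p : ℕ} [Fact p.Prime] {L G : Type*} [Field L] [CharP L p] [Group G] [Finite G]

/-- The centre is a finite-dimensional commutative algebra, hence Artinian. Its idempotents
correspond to the clopen subsets of a finite spectrum. -/
theorem finite_central_idempotents (S : Subalgebra L (MonoidAlgebra L G)) :
    {a | a ∈ centerOf S ∧ a * a = a}.Finite := by
  let _ : CommRing (centerOf S) :=
    { (inferInstance : Ring (centerOf S)) with
      mul_comm := fun a b => Subtype.ext (centerOf_comm a.2 b.2) }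
  have : IsArtinianRing (centerOf S) := IsArtinianRing.of_finite L _
  have h1 : Finite {e : centerOf S // IsIdempotentElem e} := by
    refine Finite.of_injective (fun e => (PrimeSpectrum.isIdempotentElemEquivClopens e).carrier) ?_
    intro a b hab
    exact PrimeSpectrum.isIdempotentElemEquivClopens.injective (SetLike.coe_injective hab)
  refine (Set.finite_range fun e : {e : centerOf S // IsIdempotentElem e} =>
    (e.1 : MonoidAlgebra L G)).subset ?_
  rintro a ⟨ha, haa⟩
  exact ⟨⟨⟨a, ha⟩, Subtype.ext haa⟩, rfl⟩

/-- The coefficients of a central idempotent of `L C_G(Q)` lie in a finite field. -/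
theorem exists_coeff_pow_eq {Q : Subgroup G} {e : MonoidAlgebra L G}
    (he : e ∈ centerOf (centralizerAlgebra L Q)) (hee : e * e = e) :
    ∃ n, 0 < n ∧ ∀ g, e.coeff g ^ p ^ n = e.coeff g := by
  let T := {a : MonoidAlgebra L G | a ∈ centerOf (centralizerAlgebra L Q) ∧ a * a = a}
  have : Finite T := finite_central_idempotents _
  let φ := MonoidAlgebra.mapRingHom G (frobenius L p)
  have hφ : ∀ a g, (φ a).coeff g = a.coeff g ^ p := fun a g => by simp [φ, frobenius_def]
  have hT : ∀ a ∈ T, φ a ∈ T := by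
    rintro a ⟨ha, haa⟩
    refine ⟨?_, by rw [← map_mul, haa]⟩
    rw [mem_centerOf_centralizerAlgebra] at ha ⊢
    refine ⟨fun g hg => ha.1 g fun h0 => hg ?_, fun x hx g => ?_⟩
    · rw [hφ, h0, zero_pow (Nat.Prime.ne_zero Fact.out)]
    · rw [hφ, hφ, ha.2 x hx g]
  let f : T → T := fun a => ⟨φ a, hT a a.2⟩
  have hf : Function.Injective f := by
    intro a b hab
    refine Subtype.ext ?_
    ext g
    have h1 := congrArg (fun c : T => c.1.coeff g) hab
    simp only [f, hφ] at h1
    exact frobenius_inj L p h1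
  -- The coefficientwise Frobenius map is an injective self-map of the finite set `T`, so `e` is
  -- periodic; `n` is a period.
  obtain ⟨n, hn, h⟩ := hf.mem_periodicPts ⟨e, he, hee⟩
  refine ⟨n, hn, fun g => ?_⟩
  have hiter : ∀ (m : ℕ) (a : T), (f^[m] a).1.coeff g = a.1.coeff g ^ p ^ m := by
    intro m
    induction m with
    | zero => simp
    | succ m ih =>
      intro a
      rw [Function.iterate_succ_apply', hφ, ih, ← pow_mul, pow_succ]
  rw [← hiter n ⟨e, he, hee⟩, h]

end Frobenius

/-! ### The fields `K(a)` and the stabilizers of `a` -/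

section CoefficientField

variable {K L G : Type*} [Field K] [Field L] [Algebra K L] [Group G]

theorem fixingSubgroup_coeffField (a : MonoidAlgebra L G) :
    (coeffField K a).fixingSubgroup = stabilizer Gal(L/K) a := by
  ext γ
  -- Replacing `γ` by the group it generates lets the Galois connection turn the claim into a
  -- containment of the adjoined coefficients in a fixed field.
  rw [← Subgroup.zpowers_le, ← IntermediateField.le_iff_le, coeffField,
    IntermediateField.adjoin_le_iff, mem_stabilizer_iff]
  constructor
  · intro h
    ext g
    rw [MonoidAlgebra.coeff_smul_apply]
    exact h ⟨g, rfl⟩ ⟨γ, Subgroup.mem_zpowers γ⟩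
  · rintro h _ ⟨g, rfl⟩ ⟨δ, hδ⟩
    have h1 : δ ∈ stabilizer Gal(L/K) a := by
      have : Subgroup.zpowers γ ≤ stabilizer Gal(L/K) a := by
        rwa [Subgroup.zpowers_le, mem_stabilizer_iff]
      exact this hδ
    have h2 := congrArg (fun c => c.coeff g) (mem_stabilizer_iff.1 h1)
    exact h2

theorem coeffField_le_coeffField [FiniteDimensional K L] [IsGalois K L] {a c : MonoidAlgebra L G}
    (h : stabilizer Gal(L/K) a ≤ stabilizer Gal(L/K) c) : coeffField K c ≤ coeffField K a := by
  rw [← fixingSubgroup_coeffField, ← fixingSubgroup_coeffField] at h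
  have h1 := IntermediateField.fixedField_antitone h
  rwa [IsGalois.fixedField_fixingSubgroup, IsGalois.fixedField_fixingSubgroup] at h1

/-- The solutions of `x ^ p ^ n = x` form a finite subfield that contains the coefficients of `e`
and is stable under all automorphisms. Elements of `B` trivial on it fix `e`, so the quotient is an
image of a subgroup of a cyclic group. -/
theorem isCyclic_quotient_stabilizer {p : ℕ} [Fact p.Prime] [CharP L p] [Finite G]
    {Q : Subgroup G} {e : MonoidAlgebra L G} (he : e ∈ centerOf (centralizerAlgebra L Q))
    (hee : e * e = e) (B : Subgroup Gal(L/K))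
    [((stabilizer Gal(L/K) e).subgroupOf B).Normal] :
    IsCyclic (B ⧸ (stabilizer Gal(L/K) e).subgroupOf B) := by
  obtain ⟨n, hn, h⟩ := exists_coeff_pow_eq he hee
  let F : Subfield L := (iterateFrobenius L p n).eqLocusField (RingHom.id L)
  have hF : ∀ x, x ∈ F ↔ x ^ p ^ n = x := fun x => by
    rw [RingHom.mem_eqLocusField, iterateFrobenius_def, RingHom.id_apply]
  have : Finite F := by
    refine (Polynomial.finite_setOfPred_isRoot (FiniteField.X_pow_card_pow_sub_X_ne_zero L hn.ne'
      (Nat.Prime.one_lt (Fact.out : p.Prime)))).subset fun x hx => ?_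
    have := (hF x).1 hx
    simp [Polynomial.IsRoot, this]
  obtain ⟨C, _, _, ρ, hρ⟩ := exists_cyclic_restriction (p := p) (K := K) F fun γ x hx => by
    rw [hF] at hx ⊢
    rw [← map_pow, hx]
  refine isCyclic_quotient_of_ker_le (ρ.comp B.subtype) _ fun γ hγ => ?_
  rw [Subgroup.mem_subgroupOf, mem_stabilizer_iff]
  ext g
  rw [MonoidAlgebra.coeff_smul_apply]
  exact hρ γ hγ _ ((hF _).2 (h g))

end CoefficientField

/-! ### Galois orbit sums and conjugation -/

section ConjugateSum

variable {K L G : Type*} [Field K] [Field L] [Algebra K L] [Group G]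

/-- In this form the sum visibly depends only on the orbit, which makes its behaviour under both
actions immediate. -/
theorem conjugateSum_eq_sum_orbit (e : MonoidAlgebra L G) [Fintype (orbit Gal(L/K) e)] :
    conjugateSum K e = ∑ a : orbit Gal(L/K) e, (a : MonoidAlgebra L G) := by
  rw [conjugateSum, ← finsum_eq_sum_of_fintype]
  exact finsum_eq_of_bijective _ (orbitEquivQuotientStabilizer Gal(L/K) e).symm.bijective
    fun q => rfl

theorem conj_smul_comm (x : G) (γ : Gal(L/K)) (a : MonoidAlgebra L G) :
    conj L x (γ • a) = γ • conj L x a := by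
  ext g
  simp [coeff_conj]

variable [FiniteDimensional K L]

instance finite_gal_orbit (e : MonoidAlgebra L G) : Finite (orbit Gal(L/K) e) :=
  (Set.finite_range fun γ : Gal(L/K) => γ • e).to_subtype

theorem conjugateSum_smul (e : MonoidAlgebra L G) (γ : Gal(L/K)) :
    conjugateSum K (γ • e) = conjugateSum K e := by
  have := Fintype.ofFinite (orbit Gal(L/K) e)
  have := Fintype.ofFinite (orbit Gal(L/K) (γ • e))
  rw [conjugateSum_eq_sum_orbit, conjugateSum_eq_sum_orbit]
  exact Fintype.sum_equiv (Equiv.setCongr (orbit_smul γ e)) _ _ fun _ => rfl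

theorem conj_conjugateSum (x : G) (e : MonoidAlgebra L G) :
    conj L x (conjugateSum K e) = conjugateSum K (conj L x e) := by
  have := Fintype.ofFinite (orbit Gal(L/K) e)
  have := Fintype.ofFinite (orbit Gal(L/K) (conj L x e))
  rw [conjugateSum_eq_sum_orbit, conjugateSum_eq_sum_orbit, map_sum]
  refine Fintype.sum_equiv ((conj L x).toEquiv.subtypeEquiv fun a => ?_) _ _ fun _ => rfl
  constructor
  · rintro ⟨γ, rfl⟩
    exact ⟨γ, (conj_smul_comm x γ e).symm⟩
  · rintro ⟨γ, hγ⟩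
    refine ⟨γ, (conj L x).injective ?_⟩
    exact (conj_smul_comm x γ e).trans hγ

end ConjugateSum

/-! ### Stabilizers of a Brauer pair in `G`, `Γ` and `G × Γ` -/

namespace BrauerPair

variable {p : ℕ} {K L G : Type*} [Field K] [Field L] [Algebra K L] [Group G]

theorem isBlockIdempotent_smul {b : MonoidAlgebra L G}
    (hb : IsBlockIdempotent (⊤ : Subalgebra L (MonoidAlgebra L G)) b) (γ : Gal(L/K)) :
    IsBlockIdempotent (⊤ : Subalgebra L (MonoidAlgebra L G)) (γ • b) := by
  -- The Galois action on Brauer pairs already contains the claim. The first component is trivial,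
  -- so any prime parameter serves, here `0`.
  have h := (γ • ofBlock 0 b hb).isBlock
  rwa [gal_smul_P, show (ofBlock 0 b hb).P = ⊥ from rfl, centralizerAlgebra_bot] at h

theorem stabilizer_gal_eq (X : BrauerPair p L G) :
    stabilizer Gal(L/K) X = stabilizer Gal(L/K) X.e := by
  ext γ
  rw [mem_stabilizer_iff, mem_stabilizer_iff]
  exact ⟨fun h => congrArg BrauerPair.e h, fun h => BrauerPair.ext rfl h⟩

theorem mul_conjugateSum [FiniteDimensional K L] (X : BrauerPair p L G) :
    X.e * conjugateSum K X.e = X.e := by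
  classical
  have := Fintype.ofFinite (orbit Gal(L/K) X.e)
  rw [conjugateSum_eq_sum_orbit, Finset.mul_sum,
    Finset.sum_eq_single_of_mem ⟨X.e, mem_orbit_self _⟩ (Finset.mem_univ _), X.isBlock.idem]
  rintro ⟨_, γ, rfl⟩ - hne
  exact X.isBlock.mul_eq_zero (γ • X).isBlock fun h => hne (Subtype.ext h.symm)

theorem conj_mapRingHom (x : G) (a : MonoidAlgebra K G) :
    conj L x (MonoidAlgebra.mapRingHom G (algebraMap K L) a) =
      MonoidAlgebra.mapRingHom G (algebraMap K L) (conj K x a) := by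
  ext g
  simp [coeff_conj]

theorem smul_descend_eq_iff [FiniteDimensional K L] [IsGalois K L] (X : BrauerPair p L G) (x : G) :
    x • X.descend K = X.descend K ↔
      MulAut.conj x • X.P = X.P ∧ conj L x (conjugateSum K X.e) = conjugateSum K X.e := by
  rw [← mapRingHom_descent, conj_mapRingHom, (mapRingHom_injective K L G).eq_iff]
  exact ⟨fun h => ⟨congrArg BrauerPair.P h, congrArg BrauerPair.e h⟩,
    fun h => BrauerPair.ext h.1 h.2⟩

theorem map_fst_stabilizer [FiniteDimensional K L] [IsGalois K L] (X : BrauerPair p L G) :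
    (stabilizer (G × Gal(L/K)) X).map (MonoidHom.fst G Gal(L/K)) =
      stabilizer G (X.descend K) := by
  ext x
  rw [mem_stabilizer_iff, smul_descend_eq_iff]
  constructor
  · rintro ⟨⟨x, γ⟩, h, rfl⟩
    replace h : x • γ • X = X := h
    have he : conj L x (γ • X.e) = X.e := congrArg BrauerPair.e h
    refine ⟨congrArg BrauerPair.P h, ?_⟩
    change conj L x _ = _
    rw [← conjugateSum_smul X.e γ, conj_conjugateSum, he, conjugateSum_smul]
  · rintro ⟨hP, hc⟩
    have := Fintype.ofFinite (orbit Gal(L/K) X.e)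
    have h1 := (x • X).mul_conjugateSum (K := K)
    rw [smul_e, ← conj_conjugateSum, hc, conjugateSum_eq_sum_orbit, Finset.mul_sum] at h1
    -- Since `c_x(e)` times the Galois orbit sum of `e` is `c_x(e) ≠ 0`, some Galois conjugate of
    -- `e` has a nonzero product with it. Both are blocks of the same algebra, so they coincide.
    have h2 : ∃ a : orbit Gal(L/K) X.e, conj L x X.e * a ≠ 0 := by
      by_contra! h0
      rw [Finset.sum_eq_zero fun a _ => h0 a] at h1
      exact (x • X).isBlock.ne_zero h1.symm
    obtain ⟨⟨_, γ, rfl⟩, h2⟩ := h2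
    have h3 : x • X = γ • X := by
      refine BrauerPair.ext hP ?_
      by_contra hne
      have hb := (γ • X).isBlock
      rw [gal_smul_P, ← hP] at hb
      exact h2 ((x • X).isBlock.mul_eq_zero hb hne)
    refine ⟨(x, γ⁻¹), ?_, rfl⟩
    change x • γ⁻¹ • X = X
    rw [smul_comm, h3, inv_smul_smul]

theorem goursatFst_stabilizer (X : BrauerPair p L G) :
    (stabilizer (G × Gal(L/K)) X).goursatFst = stabilizer G X := by
  ext x
  rw [Subgroup.mem_goursatFst, mem_stabilizer_iff, mem_stabilizer_iff, prod_smul_def, one_smul]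

theorem goursatSnd_stabilizer (X : BrauerPair p L G) :
    (stabilizer (G × Gal(L/K)) X).goursatSnd = stabilizer Gal(L/K) X.e := by
  ext x
  rw [Subgroup.mem_goursatSnd, ← stabilizer_gal_eq, mem_stabilizer_iff, mem_stabilizer_iff,
    prod_smul_def, one_smul]

variable [Fact p.Prime] [CharP L p] [Finite G] {b : MonoidAlgebra L G}

theorem map_snd_stabilizer (hb : IsBlockIdempotent (⊤ : Subalgebra L (MonoidAlgebra L G)) b)
    {X : BrauerPair p L G} (hX : Maximal (Belongs b) X) :
    (stabilizer (G × Gal(L/K)) X).map (MonoidHom.snd G Gal(L/K)) = stabilizer Gal(L/K) b := by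
  ext γ
  rw [mem_stabilizer_iff]
  constructor
  · rintro ⟨⟨x, γ⟩, h, rfl⟩
    replace h : x • γ • X = X := h
    have hγb := isBlockIdempotent_smul hb γ
    have h1 := belongs_smul x (belongs_gal_smul γ hX.1)
    rw [h, conj_eq_self_of_mem_centerOf hγb.mem] at h1
    exact eq_of_belongs hγb hb h1 hX.1
  · intro hγ
    -- As `γ` fixes `b`, the pair `γ • X` is maximal for the same block, and conjugacy supplies `x`
    -- with `x • γ • X = X`.
    obtain ⟨x, hx⟩ := mem_orbit_of_maximal hb (maximal_gal_smul hγ hX) hX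
    exact ⟨(x, γ), hx, rfl⟩

/-- If `γ` fixes `Q`, then `γ • R` and `R` both lie below `Q` with the same first component, so
uniqueness applies. -/
theorem stabilizer_gal_le_of_le {R Q : BrauerPair p L G} (h : R ≤ Q) :
    stabilizer Gal(L/K) Q ≤ stabilizer Gal(L/K) R := by
  intro γ hγ
  rw [mem_stabilizer_iff] at hγ ⊢
  have h1 := gal_smul_le_smul γ h
  rw [hγ] at h1
  exact eq_of_le_of_le h1 h rfl

theorem stabilizer_gal_le_of_belongs
    (hb : IsBlockIdempotent (⊤ : Subalgebra L (MonoidAlgebra L G)) b) {R : BrauerPair p L G}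
    (hR : Belongs b R) : stabilizer Gal(L/K) R ≤ stabilizer Gal(L/K) b := by
  intro γ hγ
  rw [mem_stabilizer_iff] at hγ ⊢
  have h1 := belongs_gal_smul γ hR
  rw [hγ] at h1
  exact eq_of_belongs (isBlockIdempotent_smul hb γ) hb h1 hR

end BrauerPair

end BlockTheory

theorem proposition5p1 {p : ℕ} [Fact p.Prime] {K L G : Type*} [Field K] [CharP K p] [Field L]
    [Algebra K L] [FiniteDimensional K L] [IsGalois K L] [Group G] [Finite G]
    (b : MonoidAlgebra L G)
    (hb : IsBlockIdempotent (⊤ : Subalgebra L (MonoidAlgebra L G)) b)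
    (X : BrauerPair p L G) (hX : Maximal (BrauerPair.Belongs b) X) :
    -- (a) the stabilizers decrease along Brauer pairs
    (stabilizer Gal(L/K) X = stabilizer Gal(L/K) X.e ∧
      stabilizer Gal(L/K) (BrauerPair.ofBlock p b hb) = stabilizer Gal(L/K) b ∧
      (∀ R Q : BrauerPair p L G, R ≤ Q → Q ≤ X →
        stabilizer Gal(L/K) X ≤ stabilizer Gal(L/K) Q ∧
        stabilizer Gal(L/K) Q ≤ stabilizer Gal(L/K) R ∧
        stabilizer Gal(L/K) R ≤ stabilizer Gal(L/K) (BrauerPair.ofBlock p b hb)) ∧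
      coeffField K b ≤ coeffField K X.e) ∧
    -- (b) the Goursat invariants `k₁, p₁, k₂, p₂` of the stabilizer in `G × Γ`
    ((stabilizer (G × Gal(L/K)) X).goursatFst = stabilizer G X ∧
      (stabilizer (G × Gal(L/K)) X).map (MonoidHom.fst G Gal(L/K)) =
        stabilizer G (X.descend K) ∧
      (stabilizer (G × Gal(L/K)) X).goursatSnd = stabilizer Gal(L/K) X.e ∧
      (stabilizer (G × Gal(L/K)) X).map (MonoidHom.snd G Gal(L/K)) =
        stabilizer Gal(L/K) b) ∧
    -- (c) the quotients, and the extension `K(e) / K(b)`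
    (stabilizer G X ≤ stabilizer G (X.descend K) ∧
      stabilizer Gal(L/K) X.e ≤ stabilizer Gal(L/K) b ∧
      ∃ (_ : ((stabilizer G X).subgroupOf (stabilizer G (X.descend K))).Normal)
        (_ : ((stabilizer Gal(L/K) X.e).subgroupOf (stabilizer Gal(L/K) b)).Normal)
        (h : coeffField K b ≤ coeffField K X.e),
        Nonempty
          ((stabilizer G (X.descend K) ⧸
              (stabilizer G X).subgroupOf (stabilizer G (X.descend K))) ≃*
            (stabilizer Gal(L/K) b ⧸
              (stabilizer Gal(L/K) X.e).subgroupOf (stabilizer Gal(L/K) b))) ∧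
        IsGalois (coeffField K b) (IntermediateField.extendScalars h) ∧
        IsCyclic Gal(IntermediateField.extendScalars h/coeffField K b) ∧
        Nonempty
          (Gal(IntermediateField.extendScalars h/coeffField K b) ≃*
            (stabilizer G (X.descend K) ⧸
              (stabilizer G X).subgroupOf (stabilizer G (X.descend K))))) := by
  have : CharP L p := charP_of_injective_algebraMap (algebraMap K L).injective p
  have hXe := BrauerPair.stabilizer_gal_eq (K := K) X
  have hob : stabilizer Gal(L/K) (BrauerPair.ofBlock p b hb) = stabilizer Gal(L/K) b :=
    BrauerPair.stabilizer_gal_eq _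
  have heb : stabilizer Gal(L/K) X.e ≤ stabilizer Gal(L/K) b :=
    hXe ▸ BrauerPair.stabilizer_gal_le_of_belongs hb hX.1
  have hfield := coeffField_le_coeffField heb
  have hk1 := BrauerPair.goursatFst_stabilizer (K := K) X
  have hp1 := BrauerPair.map_fst_stabilizer (K := K) X
  have hk2 := BrauerPair.goursatSnd_stabilizer (K := K) X
  have hp2 := BrauerPair.map_snd_stabilizer (K := K) hb hX
  obtain ⟨hle, -, hN, hΓ, ⟨iso⟩⟩ := goursat_quotients _ hk1 hp1 hk2 hp2
  refine ⟨⟨hXe, hob, fun R Q hRQ hQX => ⟨BrauerPair.stabilizer_gal_le_of_le hQX,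
    BrauerPair.stabilizer_gal_le_of_le hRQ, ?_⟩, hfield⟩, ⟨hk1, hp1, hk2, hp2⟩,
    hle, heb, hN, hΓ, hfield, ⟨iso⟩, ?_⟩
  -- Membership in `b` passes down one containment at a time, from `X` to `Q` to `R`, so
  -- transitivity of `≤` is not needed.
  · rw [hob]
    exact BrauerPair.stabilizer_gal_le_of_belongs hb
      (BrauerPair.belongs_of_le hb hRQ (BrauerPair.belongs_of_le hb hQX hX.1))
  · have hcyc := isCyclic_quotient_stabilizer X.isBlock.mem X.isBlock.idem
      (stabilizer Gal(L/K) b)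
    obtain ⟨hG, ⟨φ⟩⟩ := isGalois_extendScalars hfield (fixingSubgroup_coeffField b)
      (fixingSubgroup_coeffField X.e)
    exact ⟨hG, isCyclic_of_surjective φ.symm φ.symm.surjective, ⟨φ.trans iso.symm⟩⟩
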